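/- A non-quasianalytic weight function is a continuous increasing function $\omega:[0,\infty)\to[0,\infty)$ such that - $(\alpha)$ there is $K\ge 1$ with $\omega(2t)\le K(1+\omega(t))$ for all $t\ge 0$; - $(\beta)$ $\int_1^\infty \frac{\omega(t)}{1+t^2}\,dt<\infty$; - $(\gamma)$ there are $a\in\mathbb R$, $b>0$ with $\omega(t)\ge a+b\log(1+t)$ for all $t\ge 0$; - $(\delta)$ $\varphi_\omega(t)=\omega(e^t)$ is convex on $\mathbb R$. Put $\omega(x)=\omega(|x|)$ for $x\in\mathbb R^N$ and $\varphi^*_\omega(s)=\sup_{t\ge 0}\{st-\varphi_\omega(t)\}\in(-\infty,\infty]$ for $s\ge 0$, with $e^{-\infty}=0$. All functions are complex valued, $\mathbb N=\{1,2,\dots\}$ and $\hat f(\xi)=\int_{\mathbb R^N}f(x)e^{-ix\xi}\,dx$. - $\mathcal E_\omega(\mathbb R^N)$ is the space of all $f\in C^\infty(\mathbb R^N)$ with $$p_{K,m}(f)=\sup_{x\in K}\sup_{\alpha\in\mathbb N_0^N}|\partial^\alpha f(x)|\,e^{-m\varphi^*_\omega(|\alpha|/m)}<\infty$$ for all compact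 $K\subset\mathbb R^N$ and $m\in\mathbb N$, with the topology generated by the seminorms $p_{K,m}$. - $\mathcal O_{M,\omega}(\mathbb R^N)$ is the space of all $f\in C^\infty(\mathbb R^N)$ such that for each $m\in\mathbb N$ there is $n\in\mathbb N$ with $$\sup_{\alpha\in\mathbb N_0^N}\sup_{x\in\mathbb R^N}|\partial^\alpha f(x)|\,e^{-n\omega(x)-m\varphi^*_\omega(|\alpha|/m)}<\infty.$$ - $\mathcal S_\omega(\mathbb R^N)$ is the set of all $g\in L^1(\mathbb R^N)$ such that $g,\hat g\in C^\infty(\mathbb R^N)$ and $e^{\lambda\omega}\partial^\alpha g$, $e^{\lambda\omega}\partial^\alpha\hat g$ are bounded for all $\lambda>0$ and $\alpha\in\mathbb N_0^N$. - $\tau$ is the topology on $\mathcal O_{M,\omega}(\mathbb R^N)$ generated by the seminorms $$q_{m,g}(f)=\sup_{\alpha\in\mathbb N_0^N}\sup_{x\in\mathbb R^N}|g(x)|\,|\partial^\alpha f(x)|\,e^{-m\varphi^*_\omega(|\alpha|/m)},\qquad m\in\mathbb N,\ g\in\mathcal S_\omega(\mathbb R^N),$$ which are finite on $\mathcal O_{M,\omega}(\mathbb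 R^N)$. **Theorem.** Let $\omega$ be a non-quasianalytic weight function. Then: 1. $\mathcal O_{M,\omega}(\mathbb R^N)\subset\mathcal E_\omega(\mathbb R^N)$ and the inclusion $(\mathcal O_{M,\omega}(\mathbb R^N),\tau)\hookrightarrow\mathcal E_\omega(\mathbb R^N)$ is continuous with dense range. 2. $(\mathcal O_{M,\omega}(\mathbb R^N),\tau)$ is a complete Hausdorff locally convex space. -/

import Mathlib

open Set MeasureTheory
open scoped ENNReal

/-- A non-quasianalytic weight function: a continuous increasing function
`ω : [0, ∞) → [0, ∞)` with the properties `(α)`, `(β)`, `(γ)`, `(δ)` of Braun, Meise and Taylor.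
Only the values of `toFun` on `[0, ∞)` matter. -/
structure NQWeight where
  /-- The underlying function. -/
  toFun : ℝ → ℝ
  nonneg : ∀ t, 0 ≤ t → 0 ≤ toFun t
  continuousOn : ContinuousOn toFun (Ici 0)
  monotoneOn : MonotoneOn toFun (Ici 0)
  alpha : ∃ K : ℝ, 1 ≤ K ∧ ∀ t, 0 ≤ t → toFun (2 * t) ≤ K * (1 + toFun t)
  beta : IntegrableOn (fun t => toFun t / (1 + t ^ 2)) (Ioi 1) volume
  gamma : ∃ a b : ℝ, 0 < b ∧ ∀ t, 0 ≤ t → a + b * Real.log (1 + t) ≤ toFun t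
  delta : ConvexOn ℝ univ (fun t => toFun (Real.exp t))

instance : CoeFun NQWeight (fun _ => ℝ → ℝ) := ⟨NQWeight.toFun⟩

namespace NQWeight

/-- The Young conjugate `φ*(s) = sup_{t ≥ 0} (s t - φ(t))` of `φ(t) = ω(e^t)`. It may take the
value `∞` (when `ω` grows like the logarithm), so it is extended-real valued. -/
noncomputable def young (ω : NQWeight) (s : ℝ) : EReal :=
  ⨆ t : Ici (0 : ℝ), ((s * (t : ℝ) - ω (Real.exp t) : ℝ) : EReal)

/-- The factor `exp (-λ φ*(k / λ))`, for `λ > 0`; it is `0` where `φ*(k / λ) = ∞`. -/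
noncomputable def factor (ω : NQWeight) (lam : ℝ) (k : ℕ) : ℝ≥0∞ :=
  EReal.exp (-((lam : EReal) * ω.young ((k : ℝ) / lam)))

end NQWeight

/-- The partial derivative `∂^α f (x)` of a smooth function, `α` a multi-index: the derivative of
order `|α|` of `f` at `x` applied to `α 0` copies of the first standard basis vector, `α 1` copies
of the second one, and so on. -/
noncomputable def partialDeriv {N : ℕ} (α : Fin N → ℕ) (f : EuclideanSpace ℝ (Fin N) → ℂ)
    (x : EuclideanSpace ℝ (Fin N)) : ℂ :=
  iteratedFDeriv ℝ (∑ i, α i) f x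
    (fun j => EuclideanSpace.single (finSigmaFinEquiv.symm j).1 (1 : ℝ))

/-- The Fourier transform `f̂(ξ) = ∫ f(x) e^{-i x ξ} dx`. -/
noncomputable def fourierHat {N : ℕ} (f : EuclideanSpace ℝ (Fin N) → ℂ)
    (ξ : EuclideanSpace ℝ (Fin N)) : ℂ :=
  ∫ x, f x * Complex.exp (-(Complex.I * ((inner ℝ x ξ : ℝ) : ℂ)))

/-- The space `S_ω(ℝ^N)`: integrable smooth `f` with smooth Fourier transform such that
`exp(λ ω) ∂^α f` and `exp(λ ω) ∂^α f̂` are bounded for all `λ > 0` and all `α`. -/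
structure MemS (ω : NQWeight) {N : ℕ} (f : EuclideanSpace ℝ (Fin N) → ℂ) : Prop where
  integrable : Integrable f volume
  contDiff : ContDiff ℝ (⊤ : ℕ∞) f
  contDiff_hat : ContDiff ℝ (⊤ : ℕ∞) (fourierHat f)
  bound : ∀ lam : ℝ, 0 < lam → ∀ α : Fin N → ℕ,
    ∃ C : ℝ, ∀ x, Real.exp (lam * ω ‖x‖) * ‖partialDeriv α f x‖ ≤ C
  bound_hat : ∀ lam : ℝ, 0 < lam → ∀ α : Fin N → ℕ,
    ∃ C : ℝ, ∀ ξ, Real.exp (lam * ω ‖ξ‖) * ‖partialDeriv α (fourierHat f) ξ‖ ≤ C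

/-- `p_{K,m}(f) = sup_{x ∈ K} sup_α |∂^α f(x)| exp(-m φ*(|α|/m))`. -/
noncomputable def pSup (ω : NQWeight) {N : ℕ} (K : Set (EuclideanSpace ℝ (Fin N))) (m : ℕ+)
    (f : EuclideanSpace ℝ (Fin N) → ℂ) : ℝ≥0∞ :=
  ⨆ x ∈ K, ⨆ α : Fin N → ℕ, ‖partialDeriv α f x‖ₑ * ω.factor m (∑ i, α i)

/-- `r_{m,n}(f) = sup_α sup_x |∂^α f(x)| exp(-n ω(x) - m φ*(|α|/m))`. -/
noncomputable def rSup (ω : NQWeight) {N : ℕ} (m n : ℕ+)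
    (f : EuclideanSpace ℝ (Fin N) → ℂ) : ℝ≥0∞ :=
  ⨆ (α : Fin N → ℕ) (x : EuclideanSpace ℝ (Fin N)),
    ‖partialDeriv α f x‖ₑ * (ENNReal.ofReal (Real.exp (-((n : ℝ) * ω ‖x‖))) *
      ω.factor m (∑ i, α i))

/-- `q_{m,g}(f) = sup_α sup_x |g(x)| |∂^α f(x)| exp(-m φ*(|α|/m))`. -/
noncomputable def qSup (ω : NQWeight) {N : ℕ} (m : ℕ+)
    (g f : EuclideanSpace ℝ (Fin N) → ℂ) : ℝ≥0∞ :=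
  ⨆ (α : Fin N → ℕ) (x : EuclideanSpace ℝ (Fin N)),
    ‖g x‖ₑ * ‖partialDeriv α f x‖ₑ * ω.factor m (∑ i, α i)

section Helpers

variable {N : ℕ} {f h : EuclideanSpace ℝ (Fin N) → ℂ}

theorem partialDeriv_add (hf : ContDiff ℝ (⊤ : ℕ∞) f) (hh : ContDiff ℝ (⊤ : ℕ∞) h) (α : Fin N → ℕ)
    (x : EuclideanSpace ℝ (Fin N)) :
    partialDeriv α (f + h) x = partialDeriv α f x + partialDeriv α h x := by
  unfold partialDeriv
  rw [iteratedFDeriv_add (hf.of_le (by exact_mod_cast le_top))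
    (hh.of_le (by exact_mod_cast le_top))]
  rfl

theorem partialDeriv_smul (c : ℂ) (hf : ContDiff ℝ (⊤ : ℕ∞) f) (α : Fin N → ℕ)
    (x : EuclideanSpace ℝ (Fin N)) :
    partialDeriv α (c • f) x = c * partialDeriv α f x := by
  unfold partialDeriv
  rw [iteratedFDeriv_const_smul_apply (hf.of_le (by exact_mod_cast le_top)).contDiffAt]
  rfl

theorem partialDeriv_zero (α : Fin N → ℕ) (x : EuclideanSpace ℝ (Fin N)) :
    partialDeriv α (0 : EuclideanSpace ℝ (Fin N) → ℂ) x = 0 := by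
  have := partialDeriv_smul 0 (f := (0 : EuclideanSpace ℝ (Fin N) → ℂ)) contDiff_const α x
  simpa using this

theorem enorm_partialDeriv_add_le (hf : ContDiff ℝ (⊤ : ℕ∞) f) (hh : ContDiff ℝ (⊤ : ℕ∞) h) (α : Fin N → ℕ)
    (x : EuclideanSpace ℝ (Fin N)) :
    ‖partialDeriv α (f + h) x‖ₑ ≤ ‖partialDeriv α f x‖ₑ + ‖partialDeriv α h x‖ₑ := by
  rw [partialDeriv_add hf hh]
  exact enorm_add_le _ _

variable (ω : NQWeight)

theorem pSup_add_le (K : Set (EuclideanSpace ℝ (Fin N))) (m : ℕ+)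
    (hf : ContDiff ℝ (⊤ : ℕ∞) f) (hh : ContDiff ℝ (⊤ : ℕ∞) h) :
    pSup ω K m (f + h) ≤ pSup ω K m f + pSup ω K m h := by
  refine iSup₂_le fun x hx => iSup_le fun α => ?_
  refine (mul_le_mul_left (enorm_partialDeriv_add_le hf hh α x) _).trans ?_
  rw [add_mul]
  exact add_le_add
    (le_iSup₂_of_le x hx (le_iSup (fun α => ‖partialDeriv α f x‖ₑ * ω.factor m (∑ i, α i)) α))
    (le_iSup₂_of_le x hx (le_iSup (fun α => ‖partialDeriv α h x‖ₑ * ω.factor m (∑ i, α i)) α))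

theorem pSup_smul (K : Set (EuclideanSpace ℝ (Fin N))) (m : ℕ+) (c : ℂ)
    (hf : ContDiff ℝ (⊤ : ℕ∞) f) : pSup ω K m (c • f) = ‖c‖ₑ * pSup ω K m f := by
  simp only [pSup, partialDeriv_smul c hf, enorm_mul, mul_assoc, ENNReal.mul_iSup]

theorem rSup_add_le (m n : ℕ+) (hf : ContDiff ℝ (⊤ : ℕ∞) f) (hh : ContDiff ℝ (⊤ : ℕ∞) h) :
    rSup ω m n (f + h) ≤ rSup ω m n f + rSup ω m n h := by
  refine iSup₂_le fun α x => ?_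
  refine (mul_le_mul_left (enorm_partialDeriv_add_le hf hh α x) _).trans ?_
  rw [add_mul]
  exact add_le_add (le_iSup₂_of_le α x le_rfl) (le_iSup₂_of_le α x le_rfl)

theorem rSup_smul (m n : ℕ+) (c : ℂ) (hf : ContDiff ℝ (⊤ : ℕ∞) f) :
    rSup ω m n (c • f) = ‖c‖ₑ * rSup ω m n f := by
  simp only [rSup, partialDeriv_smul c hf, enorm_mul, mul_assoc, ENNReal.mul_iSup]

theorem rSup_anti (m : ℕ+) {n n' : ℕ+} (hn : n ≤ n') : rSup ω m n' f ≤ rSup ω m n f := by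
  refine iSup₂_mono fun α x => ?_
  gcongr
  · exact ω.nonneg _ (norm_nonneg x)
  · exact_mod_cast hn

theorem qSup_add_le (m : ℕ+) (g : EuclideanSpace ℝ (Fin N) → ℂ)
    (hf : ContDiff ℝ (⊤ : ℕ∞) f) (hh : ContDiff ℝ (⊤ : ℕ∞) h) :
    qSup ω m g (f + h) ≤ qSup ω m g f + qSup ω m g h := by
  refine iSup₂_le fun α x => ?_
  refine (mul_le_mul_left (mul_le_mul_right (enorm_partialDeriv_add_le hf hh α x) _) _).trans ?_
  rw [mul_add, add_mul]
  exact add_le_add (le_iSup₂_of_le α x le_rfl) (le_iSup₂_of_le α x le_rfl)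

theorem qSup_smul (m : ℕ+) (g : EuclideanSpace ℝ (Fin N) → ℂ) (c : ℂ) (hf : ContDiff ℝ (⊤ : ℕ∞) f) :
    qSup ω m g (c • f) = ‖c‖ₑ * qSup ω m g f := by
  simp only [qSup, partialDeriv_smul c hf, enorm_mul, ENNReal.mul_iSup]
  refine iSup_congr fun α => iSup_congr fun x => ?_
  ring

theorem pSup_zero (K : Set (EuclideanSpace ℝ (Fin N))) (m : ℕ+) :
    pSup ω K m (0 : EuclideanSpace ℝ (Fin N) → ℂ) = 0 := by
  simp [pSup, partialDeriv_zero]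

theorem rSup_zero (m n : ℕ+) : rSup ω m n (0 : EuclideanSpace ℝ (Fin N) → ℂ) = 0 := by
  simp [rSup, partialDeriv_zero]

theorem qSup_zero (m : ℕ+) (g : EuclideanSpace ℝ (Fin N) → ℂ) :
    qSup ω m g (0 : EuclideanSpace ℝ (Fin N) → ℂ) = 0 := by
  simp [qSup, partialDeriv_zero]

end Helpers

/-- `E_ω(ℝ^N)` as a vector space: the smooth `f` with `p_{K,m}(f) < ∞` for all compact `K` and
all `m = 1, 2, …`. -/
def ESubmodule (ω : NQWeight) (N : ℕ) : Submodule ℂ (EuclideanSpace ℝ (Fin N) → ℂ) where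
  carrier := {f | ContDiff ℝ (⊤ : ℕ∞) f ∧ ∀ K, IsCompact K → ∀ m : ℕ+, pSup ω K m f < ∞}
  zero_mem' := ⟨contDiff_const, fun K _ m => by simp [pSup_zero]⟩
  add_mem' hf hh := ⟨hf.1.add hh.1, fun K hK m =>
    (pSup_add_le ω K m hf.1 hh.1).trans_lt (ENNReal.add_lt_top.2 ⟨hf.2 K hK m, hh.2 K hK m⟩)⟩
  smul_mem' c f hf := ⟨contDiff_const.smul hf.1, fun K hK m => by
    rw [pSup_smul ω K m c hf.1]
    exact ENNReal.mul_lt_top enorm_lt_top (hf.2 K hK m)⟩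

/-- `O_{M,ω}(ℝ^N)` as a vector space: the smooth `f` such that for every `m = 1, 2, …` there is
`n = 1, 2, …` with `r_{m,n}(f) < ∞`. -/
def OMSubmodule (ω : NQWeight) (N : ℕ) : Submodule ℂ (EuclideanSpace ℝ (Fin N) → ℂ) where
  carrier := {f | ContDiff ℝ (⊤ : ℕ∞) f ∧ ∀ m : ℕ+, ∃ n : ℕ+, rSup ω m n f < ∞}
  zero_mem' := ⟨contDiff_const, fun m => ⟨1, by simp [rSup_zero]⟩⟩
  add_mem' := by
    rintro f h ⟨hf, hf'⟩ ⟨hh, hh'⟩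
    refine ⟨hf.add hh, fun m => ?_⟩
    obtain ⟨n₁, h₁⟩ := hf' m
    obtain ⟨n₂, h₂⟩ := hh' m
    exact ⟨max n₁ n₂, (rSup_add_le ω m _ hf hh).trans_lt (ENNReal.add_lt_top.2
      ⟨(rSup_anti ω m (le_max_left _ _)).trans_lt h₁,
        (rSup_anti ω m (le_max_right _ _)).trans_lt h₂⟩)⟩
  smul_mem' := by
    rintro c f ⟨hf, hf'⟩
    refine ⟨contDiff_const.smul hf, fun m => ?_⟩
    obtain ⟨n, hn⟩ := hf' m
    refine ⟨n, ?_⟩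
    rw [rSup_smul ω m n c hf]
    exact ENNReal.mul_lt_top enorm_lt_top hn

theorem OMSubmodule_le_ESubmodule (ω : NQWeight) (N : ℕ) :
    OMSubmodule ω N ≤ ESubmodule ω N := by
  rintro f ⟨hf, hf'⟩
  refine ⟨hf, fun K hK m => ?_⟩
  obtain ⟨n, hn⟩ := hf' m
  obtain ⟨R, hR⟩ := hK.isBounded.exists_norm_le
  have key : pSup ω K m f ≤ ENNReal.ofReal (Real.exp ((n : ℝ) * ω R)) * rSup ω m n f := by
    refine iSup₂_le fun x hx => iSup_le fun α => ?_
    have h1 : (1 : ℝ≥0∞) ≤ ENNReal.ofReal (Real.exp ((n : ℝ) * ω R)) *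
        ENNReal.ofReal (Real.exp (-((n : ℝ) * ω ‖x‖))) := by
      rw [← ENNReal.ofReal_mul (Real.exp_pos _).le, ← Real.exp_add, ENNReal.one_le_ofReal,
        Real.one_le_exp_iff]
      have := mul_le_mul_of_nonneg_left
        (ω.monotoneOn (norm_nonneg x) ((norm_nonneg x).trans (hR x hx)) (hR x hx))
        (Nat.cast_nonneg (α := ℝ) (n : ℕ))
      linarith
    calc ‖partialDeriv α f x‖ₑ * ω.factor m (∑ i, α i)
        = 1 * (‖partialDeriv α f x‖ₑ * ω.factor m (∑ i, α i)) := (one_mul _).symm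
      _ ≤ (ENNReal.ofReal (Real.exp ((n : ℝ) * ω R)) *
            ENNReal.ofReal (Real.exp (-((n : ℝ) * ω ‖x‖)))) *
            (‖partialDeriv α f x‖ₑ * ω.factor m (∑ i, α i)) := by gcongr
      _ = ENNReal.ofReal (Real.exp ((n : ℝ) * ω R)) * (‖partialDeriv α f x‖ₑ *
            (ENNReal.ofReal (Real.exp (-((n : ℝ) * ω ‖x‖))) * ω.factor m (∑ i, α i))) := by
          ring
      _ ≤ _ := by
          gcongr
          exact le_iSup₂_of_le α x le_rfl
  exact key.trans_lt (ENNReal.mul_lt_top ENNReal.ofReal_lt_top hn)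

theorem partialDeriv_zero_index {N : ℕ} (f : EuclideanSpace ℝ (Fin N) → ℂ)
    (x : EuclideanSpace ℝ (Fin N)) : ‖partialDeriv 0 f x‖ = ‖f x‖ := by
  have key : ∀ (k : ℕ) (_ : k = 0) (v : Fin k → EuclideanSpace ℝ (Fin N)),
      iteratedFDeriv ℝ k f x v = f x := by
    rintro k rfl v
    simp
  unfold partialDeriv
  rw [key _ (by simp)]

theorem qSup_lt_top (ω : NQWeight) {N : ℕ} (m : ℕ+) {g f : EuclideanSpace ℝ (Fin N) → ℂ}
    (hg : MemS ω g) (hf : f ∈ OMSubmodule ω N) : qSup ω m g f < ∞ := by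
  obtain ⟨n, hn⟩ := hf.2 m
  obtain ⟨C, hC⟩ := hg.bound n (by exact_mod_cast n.pos) 0
  have key : qSup ω m g f ≤ ENNReal.ofReal C * rSup ω m n f := by
    refine iSup₂_le fun α x => ?_
    have h1 : ‖g x‖ₑ ≤ ENNReal.ofReal C *
        ENNReal.ofReal (Real.exp (-((n : ℝ) * ω ‖x‖))) := by
      rw [← ofReal_norm, ← ENNReal.ofReal_mul' (Real.exp_pos _).le]
      apply ENNReal.ofReal_le_ofReal
      have h2 := hC x
      rw [partialDeriv_zero_index] at h2
      rw [Real.exp_neg, ← div_eq_mul_inv, le_div_iff₀ (Real.exp_pos _), mul_comm]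
      exact h2
    calc ‖g x‖ₑ * ‖partialDeriv α f x‖ₑ * ω.factor m (∑ i, α i)
        ≤ (ENNReal.ofReal C * ENNReal.ofReal (Real.exp (-((n : ℝ) * ω ‖x‖)))) *
            ‖partialDeriv α f x‖ₑ * ω.factor m (∑ i, α i) := by gcongr
      _ = ENNReal.ofReal C * (‖partialDeriv α f x‖ₑ *
            (ENNReal.ofReal (Real.exp (-((n : ℝ) * ω ‖x‖))) * ω.factor m (∑ i, α i))) := by
          ring
      _ ≤ _ := by
          gcongr
          exact le_iSup₂_of_le α x le_rfl
  exact key.trans_lt (ENNReal.mul_lt_top ENNReal.ofReal_lt_top hn)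

/-- The space `E_ω(ℝ^N)`; its topology is defined below (it does not inherit the topology of
pointwise convergence). -/
def ESpace (ω : NQWeight) (N : ℕ) : Type := ↥(ESubmodule ω N)

/-- The space `O_{M,ω}(ℝ^N)`; its topology `τ` is defined below (it does not inherit the topology
of pointwise convergence). -/
def OMSpace (ω : NQWeight) (N : ℕ) : Type := ↥(OMSubmodule ω N)

noncomputable instance (ω : NQWeight) (N : ℕ) : AddCommGroup (ESpace ω N) :=
  inferInstanceAs (AddCommGroup ↥(ESubmodule ω N))

noncomputable instance (ω : NQWeight) (N : ℕ) : Module ℂ (ESpace ω N) :=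
  inferInstanceAs (Module ℂ ↥(ESubmodule ω N))

noncomputable instance (ω : NQWeight) (N : ℕ) : AddCommGroup (OMSpace ω N) :=
  inferInstanceAs (AddCommGroup ↥(OMSubmodule ω N))

noncomputable instance (ω : NQWeight) (N : ℕ) : Module ℂ (OMSpace ω N) :=
  inferInstanceAs (Module ℂ ↥(OMSubmodule ω N))

/-- The inclusion `O_{M,ω}(ℝ^N) → E_ω(ℝ^N)`, `f ↦ f`. -/
noncomputable def inclOME (ω : NQWeight) (N : ℕ) : OMSpace ω N →ₗ[ℂ] ESpace ω N :=
  Submodule.inclusion (OMSubmodule_le_ESubmodule ω N)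

/-- The seminorms `p_{K,m}` on `E_ω(ℝ^N)`, for `K` compact and `m = 1, 2, …`. -/
noncomputable def ESeminorm (ω : NQWeight) (N : ℕ) :
    SeminormFamily ℂ (ESpace ω N) ({K : Set (EuclideanSpace ℝ (Fin N)) // IsCompact K} × ℕ+) :=
  fun i => Seminorm.of (fun f => (pSup ω i.1.1 i.2 f.1).toReal)
    (fun f h => by
      have hf := f.2.2 i.1.1 i.1.2 i.2
      have hh := h.2.2 i.1.1 i.1.2 i.2
      rw [← ENNReal.toReal_add hf.ne hh.ne]
      exact ENNReal.toReal_mono (ENNReal.add_ne_top.2 ⟨hf.ne, hh.ne⟩)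
        (pSup_add_le ω i.1.1 i.2 f.2.1 h.2.1))
    (fun c f => by
      have := congrArg ENNReal.toReal (pSup_smul ω i.1.1 i.2 c f.2.1)
      rw [ENNReal.toReal_mul, toReal_enorm] at this
      exact this)

/-- The seminorms `q_{m,g}` on `O_{M,ω}(ℝ^N)`, for `m = 1, 2, …` and `g ∈ S_ω(ℝ^N)`. -/
noncomputable def OMSeminorm (ω : NQWeight) (N : ℕ) :
    SeminormFamily ℂ (OMSpace ω N) (ℕ+ × {g : EuclideanSpace ℝ (Fin N) → ℂ // MemS ω g}) :=
  fun i => Seminorm.of (fun f => (qSup ω i.1 i.2.1 f.1).toReal)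
    (fun f h => by
      have hf := qSup_lt_top ω i.1 i.2.2 f.2
      have hh := qSup_lt_top ω i.1 i.2.2 h.2
      rw [← ENNReal.toReal_add hf.ne hh.ne]
      exact ENNReal.toReal_mono (ENNReal.add_ne_top.2 ⟨hf.ne, hh.ne⟩)
        (qSup_add_le ω i.1 i.2.1 f.2.1 h.2.1))
    (fun c f => by
      have := congrArg ENNReal.toReal (qSup_smul ω i.1 i.2.1 c f.2.1)
      rw [ENNReal.toReal_mul, toReal_enorm] at this
      exact this)

/-- `E_ω(ℝ^N)` carries the uniform structure (hence the topology) generated by the seminorms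
`p_{K,m}`. -/
noncomputable instance (ω : NQWeight) (N : ℕ) : UniformSpace (ESpace ω N) :=
  ⨅ i, (ESeminorm ω N i).toSeminormedAddCommGroup.toUniformSpace

/-- `O_{M,ω}(ℝ^N)` carries the uniform structure (hence the topology `τ`) generated by the
seminorms `q_{m,g}`. -/
noncomputable instance (ω : NQWeight) (N : ℕ) : UniformSpace (OMSpace ω N) :=
  ⨅ i, (OMSeminorm ω N i).toSeminormedAddCommGroup.toUniformSpace

theorem ESpace.withSeminorms (ω : NQWeight) (N : ℕ) : WithSeminorms (ESeminorm ω N) := by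
  have : Nonempty ({K : Set (EuclideanSpace ℝ (Fin N)) // IsCompact K} × ℕ+) :=
    ⟨⟨⟨∅, isCompact_empty⟩, 1⟩⟩
  have : IsUniformAddGroup (ESpace ω N) := isUniformAddGroup_iInf fun i =>
    @SeminormedAddCommGroup.to_isUniformAddGroup _
      (ESeminorm ω N i).toSeminormedAddCommGroup
  exact (SeminormFamily.withSeminorms_iff_uniformSpace_eq_iInf _).2 rfl

/-! The Gaussian controls everything local. By (β) and monotonicity ω grows at most linearly
(`exists_le_linear`), so the Gaussian lies in S_ω (`memS_gauss`). It is bounded below on bounded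
sets, so `qSup ω m gauss` dominates every `pSup ω K m` up to a constant, which is the continuity of
the inclusion. For suitable m it also dominates any given derivative uniformly on balls
(`exists_norm_iteratedFDeriv_le`). Hence τ is Hausdorff, and a τ-Cauchy filter converges with all
derivatives, locally uniformly, to a smooth h.

For completeness, passing to the limit inside the seminorms gives q_{m,g}(h) < ∞ for all m and g,
and `mem_OMSubmodule_of_qSup_lt_top` turns this into membership. If r_{m,n}(f) = ∞ for every n,
there are points x_n with ω(x_n) ≥ n at which some weighted derivative of f is at least n exp(n
ω(x_n)). The sum of exp(-n ω(x_n)) times the Gaussian centred at x_n is a g in S_ω, because these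
coefficients beat every exp(λ ω(x_n)) on both the space and the Fourier side. Then g(x_n) ≥ exp(-n
ω(x_n)) forces q_{m,g}(f) = ∞.

For density, f is replaced by χ f with χ a compactly supported cutoff satisfying the derivative
estimates for every m. Such χ exist by (β): an ordinary bump is averaged over infinitely many
intervals of lengths 2^{-κ_j}, which are summable and yet decrease slowly enough (`exists_scales`,
`exists_limit_iterAverage`).

The factor exp(-m φ*(k/m)) is handled throughout as the infimum over t ≥ 0 of exp(m ω(e^t) - k t).
Geometric losses L^k, from the Leibniz rule or from counting partial derivatives, are absorbed by
enlarging m, which is (α) in disguise (`exists_pow_mul_factor_le`). -/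

namespace NQWeight

/-! ### Estimates for the weight and for the factors exp(-m φ*(k/m)). -/

variable (ω : NQWeight)

theorem mono {s t : ℝ} (hs : 0 ≤ s) (hst : s ≤ t) : ω s ≤ ω t :=
  ω.monotoneOn hs (hs.trans hst) hst

/-- The Young conjugate is a supremum, so the factor is an infimum of exponentials. -/
theorem le_factor_iff (m : ℕ+) (k : ℕ) (c : ℝ≥0∞) :
    c ≤ ω.factor m k ↔
      ∀ t : ℝ, 0 ≤ t → c ≤ ENNReal.ofReal (Real.exp (m * ω (Real.exp t) - k * t)) := by
  have hm : (0 : ℝ) < m := by exact_mod_cast m.pos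
  have hmE : (0 : EReal) < ((m : ℝ) : EReal) := by exact_mod_cast hm
  have hexp : ∀ z : EReal, c ≤ EReal.exp z ↔ ENNReal.log c ≤ z := fun z => by
    rw [← ENNReal.log_le_log_iff, EReal.log_exp]
  have hmul : ∀ z : EReal, ENNReal.log c ≤ -(((m : ℝ) : EReal) * z) ↔
      z ≤ (-ENNReal.log c) / ((m : ℝ) : EReal) := fun z => by
    rw [EReal.le_div_iff_mul_le hmE (EReal.coe_ne_top _), EReal.le_neg, mul_comm]
  unfold factor young
  rw [hexp, hmul, iSup_le_iff]
  simp only [Subtype.forall, mem_Ici]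
  refine forall_congr' fun t => forall_congr' fun ht => ?_
  rw [← hmul, ← EReal.coe_mul, ← EReal.coe_neg, ← hexp, EReal.exp_coe]
  have : -((m : ℝ) * ((k : ℝ) / m * t - ω (Real.exp t))) = m * ω (Real.exp t) - k * t := by
    field_simp
    ring
  rw [this]

theorem factor_le (m : ℕ+) (k : ℕ) {t : ℝ} (ht : 0 ≤ t) :
    ω.factor m k ≤ ENNReal.ofReal (Real.exp (m * ω (Real.exp t) - k * t)) :=
  (ω.le_factor_iff m k _).1 le_rfl t ht

theorem factor_eq_iInf (m : ℕ+) (k : ℕ) :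
    ω.factor m k =
      ⨅ t : Ici (0 : ℝ), ENNReal.ofReal (Real.exp (m * ω (Real.exp t) - k * t)) :=
  le_antisymm (le_iInf fun t => ω.factor_le m k t.2)
    ((ω.le_factor_iff m k _).2 fun t ht => iInf_le (fun t : Ici (0 : ℝ) =>
      ENNReal.ofReal (Real.exp (m * ω (Real.exp t) - k * t))) ⟨t, ht⟩)

theorem factor_ne_top (m : ℕ+) (k : ℕ) : ω.factor m k ≠ ∞ :=
  ((ω.factor_le m k le_rfl).trans_lt ENNReal.ofReal_lt_top).ne

/-- Given competitors t and u in the two infima on the right, test the left infimum at the larger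
one. Moving the other point up only lowers its linear term, and its ω-term can be dropped because ω
≥ 0. -/
theorem factor_add_le (m : ℕ+) (i j : ℕ) :
    ω.factor m (i + j) ≤ ω.factor m i * ω.factor m j := by
  rw [ω.factor_eq_iInf m i, ω.factor_eq_iInf m j]
  have : Nonempty (Ici (0 : ℝ)) := ⟨⟨0, self_mem_Ici⟩⟩
  rw [mul_comm, ENNReal.mul_iInf' (fun h => absurd h ?_) (fun _ => inferInstance)]
  · refine le_iInf fun t => ?_
    rw [mul_comm, ENNReal.mul_iInf' (fun h => absurd h ENNReal.ofReal_ne_top)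
      (fun _ => inferInstance)]
    refine le_iInf fun u => ?_
    rw [← ENNReal.ofReal_mul (Real.exp_pos _).le, ← Real.exp_add]
    have key : ∀ v w : ℝ, 0 ≤ v → v ≤ w → ∀ p q : ℕ, ω.factor m (p + q) ≤
        ENNReal.ofReal (Real.exp (m * ω (Real.exp v) - p * v + (m * ω (Real.exp w) - q * w))) := by
      intro v w hv hvw p q
      refine (ω.factor_le m (p + q) (hv.trans hvw)).trans (ENNReal.ofReal_le_ofReal
        (Real.exp_le_exp.2 ?_))
      have h1 : 0 ≤ (m : ℝ) * ω (Real.exp v) :=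
        mul_nonneg (Nat.cast_nonneg _) (ω.nonneg _ (Real.exp_pos _).le)
      have h2 : (p : ℝ) * v ≤ p * w := mul_le_mul_of_nonneg_left hvw (Nat.cast_nonneg _)
      push_cast
      linarith
    rcases le_total (t : ℝ) u with h | h
    · exact key t u t.2 h i j
    · rw [add_comm i j, add_comm (_ - (i : ℝ) * _)]
      exact key u t u.2 h j i
  · rw [← ω.factor_eq_iInf]
    exact ω.factor_ne_top m j

/-- Iterated form of `(α)`. -/
theorem exists_dilation {L : ℝ} (hL : 0 ≤ L) :
    ∃ Q : ℕ+, ∀ t, 0 ≤ t → ω (L * t) ≤ Q * (1 + ω t) := by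
  obtain ⟨K, hK1, hK⟩ := ω.alpha
  have main : ∀ n : ℕ, ∃ Q : ℝ, 1 ≤ Q ∧ ∀ t, 0 ≤ t → ω (2 ^ n * t) ≤ Q * (1 + ω t) := by
    intro n
    induction n with
    | zero => exact ⟨1, le_rfl, fun t _ => by simp⟩
    | succ n ih =>
      obtain ⟨Q, hQ1, hQ⟩ := ih
      refine ⟨K * (1 + Q), by nlinarith, fun t ht => ?_⟩
      have h1 := hK (2 ^ n * t) (by positivity)
      have h2 := hQ t ht
      have h3 := ω.nonneg t ht
      rw [pow_succ', mul_assoc]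
      refine h1.trans ?_
      rw [mul_assoc]
      exact mul_le_mul_of_nonneg_left (by nlinarith) (by linarith)
  obtain ⟨n, hn⟩ := pow_unbounded_of_one_lt L one_lt_two
  obtain ⟨Q, hQ1, hQ⟩ := main n
  obtain ⟨q, hq⟩ := exists_nat_ge Q
  have hq0 : 0 < q := by
    rcases Nat.eq_zero_or_pos q with h | h
    · subst h; norm_num at hq; linarith
    · exact h
  refine ⟨⟨q, hq0⟩, fun t ht => ?_⟩
  have h1 := ω.mono (by positivity) (mul_le_mul_of_nonneg_right hn.le ht)
  refine (h1.trans (hQ t ht)).trans ?_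
  have h2 := ω.nonneg t ht
  exact mul_le_mul_of_nonneg_right hq (by linarith)

/-- Shifting t to t + log L in the infimum cancels L^k and replaces ω(e^t) by ω(L e^t), which
iterated (α) bounds by Q (1 + ω(e^t)). -/
theorem exists_pow_mul_factor_le {L : ℝ} (hL : 1 ≤ L) :
    ∃ Q : ℕ+, ∀ (m : ℕ+) (k : ℕ), ENNReal.ofReal (L ^ k) * ω.factor m k ≤
      ENNReal.ofReal (Real.exp (m * Q)) * ω.factor ((m * Q : ℕ+) : ℝ) k := by
  obtain ⟨Q, hQ⟩ := ω.exists_dilation (zero_le_one.trans hL)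
  have hL0 : 0 < L := by linarith
  refine ⟨Q, fun m k => ?_⟩
  have hne : Nonempty (Ici (0 : ℝ)) := ⟨⟨0, self_mem_Ici⟩⟩
  rw [ω.factor_eq_iInf (m * Q), ENNReal.mul_iInf' (fun h => absurd h ENNReal.ofReal_ne_top)
      (fun _ => hne)]
  refine le_iInf fun t => ?_
  have ht : (0 : ℝ) ≤ t := t.2
  refine (mul_le_mul_right (ω.factor_le m k (add_nonneg (Real.log_nonneg hL) ht)) _).trans ?_
  rw [← ENNReal.ofReal_mul (by positivity), ← ENNReal.ofReal_mul (by positivity)]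
  refine ENNReal.ofReal_le_ofReal ?_
  have h1 : L ^ k = Real.exp (k * Real.log L) := by
    rw [Real.exp_nat_mul, Real.exp_log hL0]
  rw [h1, ← Real.exp_add, ← Real.exp_add, Real.exp_le_exp, Real.exp_add, Real.exp_log hL0]
  have h2 := mul_le_mul_of_nonneg_left (hQ (Real.exp t) (Real.exp_pos _).le)
    (Nat.cast_nonneg (α := ℝ) (m : ℕ))
  push_cast
  linarith

/-- For ω of logarithmic growth the factor may vanish. By (γ), m ω(e^t) - k t stays above m a once m
b ≥ k, so each order k is seen by some m. -/
theorem exists_factor_ne_zero (k : ℕ) : ∃ m : ℕ+, ω.factor m k ≠ 0 := by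
  obtain ⟨a, b, hb, h⟩ := ω.gamma
  obtain ⟨m, hm⟩ := exists_nat_ge (k / b + 1)
  have hm0 : 0 < m := by
    rcases Nat.eq_zero_or_pos m with h0 | h0
    · subst h0
      have : 0 ≤ k / b := by positivity
      norm_num at hm
      linarith
    · exact h0
  refine ⟨⟨m, hm0⟩, ne_of_gt ?_⟩
  have hpos : 0 < ENNReal.ofReal (Real.exp (m * a)) := ENNReal.ofReal_pos.2 (Real.exp_pos _)
  refine hpos.trans_le ((ω.le_factor_iff _ _ _).2 fun t ht => ENNReal.ofReal_le_ofReal ?_)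
  rw [Real.exp_le_exp]
  have h1 := h (Real.exp t) (Real.exp_pos _).le
  have h2 : t ≤ Real.log (1 + Real.exp t) := by
    rw [Real.le_log_iff_exp_le (by positivity)]
    linarith
  have h3 : (k : ℝ) ≤ m * b := by
    rw [← div_le_iff₀ hb]
    linarith
  have h4 : (m : ℝ) * (a + b * t) ≤ m * ω (Real.exp t) :=
    mul_le_mul_of_nonneg_left (by nlinarith) (Nat.cast_nonneg _)
  have h5 := mul_le_mul_of_nonneg_right h3 ht
  simp only [PNat.mk_coe]
  linarith

theorem exists_add_le : ∃ K : ℝ, 0 ≤ K ∧ ∀ s t, 0 ≤ s → 0 ≤ t →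
    ω (s + t) ≤ K * (1 + ω s + ω t) := by
  obtain ⟨K, hK1, hK⟩ := ω.alpha
  refine ⟨K, by linarith, ?_⟩
  have key : ∀ s t, 0 ≤ s → s ≤ t → ω (s + t) ≤ K * (1 + ω s + ω t) := fun s t hs hst => by
    refine ((ω.mono (by linarith) (by linarith : s + t ≤ 2 * t)).trans
      (hK t (hs.trans hst))).trans ?_
    have := ω.nonneg s hs
    exact mul_le_mul_of_nonneg_left (by linarith) (by linarith)
  intro s t hs ht
  rcases le_total s t with h | h
  · exact key s t hs h
  · rw [add_comm s t, add_right_comm]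
    exact key t s ht h

/-- Exponentiated (γ): polynomial growth is dominated by exp(λ ω). -/
theorem exists_one_add_pow_le : ∃ A : ℝ, 0 ≤ A ∧ ∀ t, 0 ≤ t → ∀ k : ℕ,
    (1 + t) ^ k ≤ Real.exp (k * A * (1 + ω t)) := by
  obtain ⟨a, b, hb, h⟩ := ω.gamma
  refine ⟨(1 + |a|) / b, by positivity, fun t ht k => ?_⟩
  have h1 := h t ht
  have h2 := ω.nonneg t ht
  rw [mul_assoc, Real.exp_nat_mul]
  refine pow_le_pow_left₀ (by linarith) ?_ k
  rw [← Real.log_le_iff_le_exp (by linarith), div_mul_eq_mul_div, le_div_iff₀ hb]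
  have h3 := abs_nonneg a
  have h4 := neg_abs_le a
  nlinarith

theorem tendsto_atTop : Filter.Tendsto ω Filter.atTop Filter.atTop := by
  obtain ⟨a, b, hb, h⟩ := ω.gamma
  refine Filter.tendsto_atTop_mono' _ (f₁ := fun t => a + b * Real.log (1 + t)) ?_ ?_
  · filter_upwards [Filter.eventually_ge_atTop 0] with t ht using h t ht
  · exact Filter.tendsto_atTop_add_const_left _ _ (Filter.Tendsto.const_mul_atTop hb
      (Real.tendsto_log_atTop.comp (Filter.tendsto_atTop_add_const_left _ _ Filter.tendsto_id)))

/-- Dyadic form of (β). On [2^k, 2^(k+1)] one has ω(t) ≥ ω(2^k) and 1 + t² ≤ 8·4^k, so this block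
contributes at least an eighth of the k-th term to the integral. -/
theorem summable_dyadic : Summable fun k : ℕ => ω (2 ^ k) / 2 ^ k := by
  set F : ℝ → ℝ := fun t => ω t / (1 + t ^ 2) with hF
  have hpow : ∀ k : ℕ, (1 : ℝ) ≤ 2 ^ k := fun k => one_le_pow₀ one_le_two
  have hint : ∀ k : ℕ, IntervalIntegrable F volume ((2 : ℝ) ^ k) (2 ^ (k + 1)) := fun k => by
    rw [intervalIntegrable_iff_integrableOn_Ioc_of_le
      (pow_le_pow_right₀ one_le_two (Nat.le_succ k))]
    exact ω.beta.mono_set fun x hx => (hpow k).trans_lt hx.1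
  have hlow : ∀ k : ℕ, ω (2 ^ k) / 2 ^ k / 8 ≤ ∫ t in (2 : ℝ) ^ k..2 ^ (k + 1), F t := fun k => by
    have hk := hpow k
    have hle : (2 : ℝ) ^ k ≤ 2 ^ (k + 1) := pow_le_pow_right₀ one_le_two (Nat.le_succ k)
    have h0 := ω.nonneg (2 ^ k) (by positivity)
    have h1 : ∫ _ in (2 : ℝ) ^ k..2 ^ (k + 1), ω (2 ^ k) / (8 * (2 ^ k) ^ 2) ≤
        ∫ t in (2 : ℝ) ^ k..2 ^ (k + 1), F t := by
      refine intervalIntegral.integral_mono_on hle (by simp) (hint k) fun t ht => ?_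
      have ht1 := ht.1
      have ht2 := ht.2
      rw [pow_succ] at ht2
      refine div_le_div₀ (ω.nonneg _ (by linarith)) (ω.mono (by positivity) ht1) (by positivity)
        (by nlinarith)
    refine le_trans (le_of_eq ?_) h1
    rw [intervalIntegral.integral_const, smul_eq_mul, pow_succ]
    field_simp
    ring
  have hsum : ∀ n : ℕ, ∑ k ∈ Finset.range n, ω (2 ^ k) / 2 ^ k / 8 ≤ ∫ t in Ioi (1 : ℝ), F t := by
    intro n
    refine (Finset.sum_le_sum fun k _ => hlow k).trans ?_
    rw [intervalIntegral.sum_integral_adjacent_intervals (a := fun k : ℕ => (2 : ℝ) ^ k)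
      fun k _ => hint k, intervalIntegral.integral_of_le (by simpa using hpow n)]
    refine setIntegral_mono_set ω.beta ?_ (Filter.Eventually.of_forall fun t ht => ?_)
    · refine (ae_restrict_iff' measurableSet_Ioi).2 (Filter.Eventually.of_forall fun t ht => ?_)
      exact div_nonneg (ω.nonneg _ (zero_le_one.trans (le_of_lt ht))) (by positivity)
    · exact mem_Ioi.2 ((hpow 0).trans_lt ht.1)
  have h8 : Summable fun k : ℕ => ω (2 ^ k) / 2 ^ k / 8 :=
    summable_of_sum_range_le
      (fun k => div_nonneg (div_nonneg (ω.nonneg _ (by positivity)) (by positivity)) (by norm_num))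
      hsum
  simpa using h8.mul_right 8

theorem exists_le_linear : ∃ B : ℝ, 0 ≤ B ∧ ∀ t, 0 ≤ t → ω t ≤ B * (1 + t) := by
  obtain ⟨B, hB⟩ := ω.summable_dyadic.tendsto_atTop_zero.bddAbove_range
  have hB' : ∀ k : ℕ, ω (2 ^ k) ≤ B * 2 ^ k := fun k => by
    rw [← div_le_iff₀ (by positivity)]
    exact hB ⟨k, rfl⟩
  have hB0 : 0 ≤ B := by
    have := (ω.nonneg _ (by positivity)).trans (hB' 0)
    simpa using this
  refine ⟨2 * B, by linarith, fun t ht => ?_⟩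
  rcases le_total t 1 with h | h
  · refine (ω.mono ht h).trans ?_
    have := hB' 0
    simp only [pow_zero, mul_one] at this
    nlinarith
  · obtain ⟨n, hn1, hn2⟩ := exists_nat_pow_near h one_lt_two
    refine ((ω.mono ht hn2.le).trans (hB' (n + 1))).trans ?_
    rw [pow_succ]
    nlinarith

end NQWeight

/-! ### Spare room in a convergent series, and the choice of scales. -/

/-- Take h = r^{-1/2} with r the tails of the series. Then (r_k - r_{k+1}) / √r_k ≤ 2 (√r_k -
√r_{k+1}), which telescopes. -/
theorem exists_tendsto_atTop_summable_mul {c : ℕ → ℝ} (hc0 : ∀ k, 0 ≤ c k) (hc : Summable c) :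
    ∃ h : ℕ → ℝ, (∀ k, 0 ≤ h k) ∧ Filter.Tendsto h Filter.atTop Filter.atTop ∧
      Summable fun k => h k * c k := by
  -- The geometric term keeps all tails strictly positive, even if c vanishes eventually.
  set d : ℕ → ℝ := fun k => c k + (1 / 2) ^ k with hd
  have hd0 : ∀ k, 0 < d k := fun k => add_pos_of_nonneg_of_pos (hc0 k) (by positivity)
  have hds : Summable d := hc.add summable_geometric_two
  set r : ℕ → ℝ := fun k => ∑' i, d (i + k) with hr
  have hrs : ∀ k, Summable fun i => d (i + k) := fun k => (summable_nat_add_iff k).2 hds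
  have hr0 : ∀ k, 0 < r k := fun k =>
    (hrs k).tsum_pos (fun i => (hd0 _).le) 0 (hd0 _)
  have hrec : ∀ k, r k = d k + r (k + 1) := fun k => by
    rw [hr]
    simp only
    rw [(hrs k).tsum_eq_zero_add, zero_add]
    congr 1
    exact tsum_congr fun i => by rw [add_right_comm, add_assoc]
  have hrt : Filter.Tendsto r Filter.atTop (nhds 0) := tendsto_sum_nat_add d
  refine ⟨fun k => (Real.sqrt (r k))⁻¹, fun k => by positivity, ?_, ?_⟩
  · refine Filter.Tendsto.inv_tendsto_nhdsGT_zero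
      (tendsto_nhdsWithin_iff.2 ⟨?_, Filter.Eventually.of_forall fun k => Real.sqrt_pos.2 (hr0 k)⟩)
    have := (Real.continuous_sqrt.tendsto 0).comp hrt
    rwa [Real.sqrt_zero] at this
  · have hbound : ∀ k, (Real.sqrt (r k))⁻¹ * c k ≤
        2 * Real.sqrt (r k) - 2 * Real.sqrt (r (k + 1)) := fun k => by
      have h1 := Real.sqrt_pos.2 (hr0 k)
      have h2 := Real.sqrt_pos.2 (hr0 (k + 1))
      have h3 := Real.mul_self_sqrt (hr0 k).le
      have h4 := Real.mul_self_sqrt (hr0 (k + 1)).le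
      have h5 : c k ≤ d k := le_add_of_nonneg_right (by positivity)
      have h6 := hrec k
      have h7 : 0 < (1 / 2 : ℝ) ^ k := by positivity
      rw [inv_mul_le_iff₀ h1]
      nlinarith [sq_nonneg (Real.sqrt (r k) - Real.sqrt (r (k + 1)))]
    refine summable_of_sum_range_le (c := 2 * Real.sqrt (r 0))
      (fun k => mul_nonneg (by positivity) (hc0 k)) fun n => ?_
    refine (Finset.sum_le_sum fun k _ => hbound k).trans ?_
    rw [Finset.sum_range_sub']
    have := Real.sqrt_nonneg (r n)
    linarith

namespace NQWeight

variable (ω : NQWeight)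

/-- The scales of the averaging operators that build a cutoff function. -/
theorem exists_scales : ∃ κ : ℕ → ℕ, Monotone κ ∧ Summable (fun j => ((2 : ℝ) ^ κ j)⁻¹) ∧
    ∀ m : ℕ+, ∃ C : ℝ, ∀ j : ℕ, m * ω (2 ^ (κ j + 2)) ≤ j * Real.log 2 + C := by
  obtain ⟨h, hh0, hht, hhs⟩ := exists_tendsto_atTop_summable_mul
    (c := fun k => ω (2 ^ (k + 3)) / 2 ^ (k + 3))
    (fun k => div_nonneg (ω.nonneg _ (by positivity)) (by positivity))
    ((summable_nat_add_iff (f := fun k => ω (2 ^ k) / 2 ^ k) 3).2 ω.summable_dyadic)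
  -- The length 2^{-l} is to be used about M l times. The number M l is small enough for the total
  -- length to converge, and the divergent h l makes it exceed any multiple of ω(2^(l+3)). The + 1
  -- makes every block nonempty, so that S k ≥ k.
  set M : ℕ → ℕ := fun l => ⌈h l * ω (2 ^ (l + 3))⌉₊ + 1 with hM
  set S : ℕ → ℕ := fun k => ∑ l ∈ Finset.range k, M l with hS
  have hSsucc : ∀ k, S (k + 1) = S k + M k := fun k => Finset.sum_range_succ _ _
  have hSge : ∀ k, k ≤ S k := fun k => by
    induction k with
    | zero => simp
    | succ k ih =>
      rw [hSsucc]
      simp only [hM]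
      omega
  -- The number of the block that contains j, where block k starts at S k.
  set κ : ℕ → ℕ := fun j => Nat.findGreatest (fun k => S k ≤ j) j with hκ
  have hκS : ∀ j, S (κ j) ≤ j := fun j =>
    Nat.findGreatest_spec (P := fun k => S k ≤ j) (Nat.zero_le j) (by simp [hS])
  have hκge : ∀ j n, S n ≤ j → n ≤ κ j := fun j n hn =>
    Nat.le_findGreatest ((hSge n).trans hn) hn
  have hM' : ∀ k, (M k : ℝ) * ((2 : ℝ) ^ k)⁻¹ ≤
      8 * (h k * (ω (2 ^ (k + 3)) / 2 ^ (k + 3))) + 2 * (1 / 2) ^ k := fun k => by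
    have h1 := Nat.ceil_lt_add_one (mul_nonneg (hh0 k) (ω.nonneg (2 ^ (k + 3)) (by positivity)))
    have h2 : (M k : ℝ) ≤ h k * ω (2 ^ (k + 3)) + 2 := by
      simp only [hM]
      push_cast
      linarith
    refine (mul_le_mul_of_nonneg_right h2 (by positivity)).trans (le_of_eq ?_)
    rw [pow_add, one_div, inv_pow]
    field_simp
    ring
  have hMs : Summable fun k => (M k : ℝ) * ((2 : ℝ) ^ k)⁻¹ :=
    Summable.of_nonneg_of_le (fun k => by positivity) hM'
      ((hhs.mul_left 8).add (summable_geometric_two.mul_left 2))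
  refine ⟨κ, fun i j hij => hκge _ _ ((hκS i).trans hij), ?_, fun m => ?_⟩
  · have hpart : ∀ n, ∑ j ∈ Finset.range (S n), ((2 : ℝ) ^ κ j)⁻¹ ≤
        ∑ k ∈ Finset.range n, (M k : ℝ) * ((2 : ℝ) ^ k)⁻¹ := fun n => by
      induction n with
      | zero => simp [hS]
      | succ n ih =>
        rw [hSsucc, Finset.sum_range_add,
          Finset.sum_range_succ (fun k => (M k : ℝ) * ((2 : ℝ) ^ k)⁻¹)]
        refine add_le_add ih ?_
        have : ∀ i ∈ Finset.range (M n), ((2 : ℝ) ^ κ (S n + i))⁻¹ ≤ ((2 : ℝ) ^ n)⁻¹ :=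
          fun i _ => inv_anti₀ (by positivity)
            (pow_le_pow_right₀ one_le_two (hκge _ _ (Nat.le_add_right _ _)))
        refine (Finset.sum_le_sum this).trans (le_of_eq ?_)
        simp
    refine summable_of_sum_range_le (c := ∑' k, (M k : ℝ) * ((2 : ℝ) ^ k)⁻¹)
      (fun j => by positivity) fun n => ?_
    refine ((Finset.sum_le_sum_of_subset_of_nonneg (Finset.range_mono (hSge n))
      fun j _ _ => by positivity).trans (hpart n)).trans ?_
    exact hMs.sum_le_tsum _ fun k _ => by positivity
  -- If j lies in block l + 1 with l ≥ L, the completed block l gives j ≥ M l ≥ h l ω(2^(l+3)), and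
  -- h l log 2 ≥ m. The constant covers the finitely many earlier blocks.
  · obtain ⟨L, hL⟩ := Filter.eventually_atTop.1 (hht.eventually_ge_atTop (m / Real.log 2))
    have hlog : 0 < Real.log 2 := Real.log_pos one_lt_two
    refine ⟨m * ω (2 ^ (L + 3)), fun j => ?_⟩
    have hm0 : (0 : ℝ) ≤ m := Nat.cast_nonneg _
    have hc0 : 0 ≤ (m : ℝ) * ω (2 ^ (L + 3)) :=
      mul_nonneg hm0 (ω.nonneg _ (by positivity))
    have hj0 : 0 ≤ (j : ℝ) * Real.log 2 := by positivity
    rcases lt_or_ge (κ j) (L + 1) with hlt | hge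
    · have : (m : ℝ) * ω (2 ^ (κ j + 2)) ≤ m * ω (2 ^ (L + 3)) :=
        mul_le_mul_of_nonneg_left (ω.mono (by positivity)
          (pow_le_pow_right₀ one_le_two (by omega))) hm0
      linarith
    · obtain ⟨l, hl⟩ : ∃ l, κ j = l + 1 := ⟨κ j - 1, by omega⟩
      have h1 := hL l (by omega)
      rw [div_le_iff₀ hlog] at h1
      have h2 : h l * ω (2 ^ (l + 3)) ≤ j := by
        have h3 : M l ≤ j := by
          have := hκS j
          rw [hl, hSsucc] at this
          omega
        have h4 : (M l : ℝ) ≤ j := by exact_mod_cast h3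
        have h5 := Nat.le_ceil (h l * ω (2 ^ (l + 3)))
        simp only [hM] at h4
        push_cast at h4
        linarith
      have h6 := ω.nonneg (2 ^ (l + 3)) (by positivity)
      rw [hl]
      have h7 : (m : ℝ) * ω (2 ^ (l + 3)) ≤ h l * Real.log 2 * ω (2 ^ (l + 3)) :=
        mul_le_mul_of_nonneg_right h1 h6
      have h8 := mul_le_mul_of_nonneg_right h2 hlog.le
      have h9 : (2 : ℝ) ^ (l + 1 + 2) = 2 ^ (l + 3) := by ring
      rw [h9]
      nlinarith

end NQWeight

/-! ### Partial derivatives against full Fréchet derivatives. -/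

section IteratedDirections

variable {E : Type*} [NormedAddCommGroup E] [NormedSpace ℝ E]

/-- Iterated directional derivatives; the head of the list is the last direction taken. -/
noncomputable def dirDeriv (f : E → ℂ) : List E → E → ℂ
  | [] => f
  | v :: l => fun y => fderiv ℝ (dirDeriv f l) y v

theorem contDiff_dirDeriv {f : E → ℂ} (hf : ContDiff ℝ (⊤ : ℕ∞) f) (l : List E) :
    ContDiff ℝ (⊤ : ℕ∞) (dirDeriv f l) := by
  induction l with
  | nil => exact hf
  | cons v l ih =>
    exact (ih.fderiv_right (m := ((⊤ : ℕ∞) : WithTop ℕ∞)) (by simp)).clm_apply contDiff_const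

/-- Permutations are generated by adjacent swaps, and a swap is the symmetry of the second
derivative. -/
theorem dirDeriv_perm {f : E → ℂ} (hf : ContDiff ℝ (⊤ : ℕ∞) f) {l l' : List E} (h : l.Perm l') :
    dirDeriv f l = dirDeriv f l' := by
  induction h with
  | nil => rfl
  | cons v _ ih => simp only [dirDeriv, ih]
  | swap v w l =>
    have hs := contDiff_dirDeriv hf l
    have hd : Differentiable ℝ (fderiv ℝ (dirDeriv f l)) :=
      (hs.fderiv_right (m := ((⊤ : ℕ∞) : WithTop ℕ∞)) (by simp)).differentiable (by simp)
    have key : ∀ (y a b : E), fderiv ℝ (fun z => fderiv ℝ (dirDeriv f l) z a) y b =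
        fderiv ℝ (fderiv ℝ (dirDeriv f l)) y b a := fun y a b => by
      rw [fderiv_clm_apply (hd y) (differentiableAt_const a)]
      simp
    funext y
    simp only [dirDeriv]
    rw [key, key]
    exact (hs.contDiffAt.isSymmSndFDerivAt (by
      rw [minSmoothness_of_isRCLikeNormedField]
      exact WithTop.coe_le_coe.2 (le_top : (2 : ℕ∞) ≤ ⊤))).eq _ _
  | trans _ _ h₁ h₂ => exact h₁.trans h₂

theorem iteratedFDeriv_eq_dirDeriv {f : E → ℂ} (hf : ContDiff ℝ (⊤ : ℕ∞) f) :
    ∀ (n : ℕ) (v : Fin n → E) (x : E),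
      iteratedFDeriv ℝ n f x v = dirDeriv f (List.ofFn v) x := by
  intro n
  induction n with
  | zero => intro v x; simp [dirDeriv]
  | succ n ih =>
    intro v x
    have hd : Differentiable ℝ (iteratedFDeriv ℝ n f) :=
      hf.differentiable_iteratedFDeriv (by exact_mod_cast ENat.natCast_lt_top n)
    have h1 : (fun y => iteratedFDeriv ℝ n f y (Fin.tail v)) = dirDeriv f (List.ofFn (Fin.tail v)) :=
      funext fun y => ih _ y
    rw [iteratedFDeriv_succ_apply_left, List.ofFn_succ]
    simp only [dirDeriv]
    change _ = fderiv ℝ (dirDeriv f (List.ofFn (Fin.tail v))) x (v 0)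
    rw [← h1, fderiv_continuousMultilinear_apply_const_apply (hd x)]

end IteratedDirections

section PartialDeriv

variable {N : ℕ} {f : EuclideanSpace ℝ (Fin N) → ℂ}

/-- Count the occurrences of each direction: the sorted list of directions in `partialDeriv` is then
a permutation of r. -/
theorem exists_partialDeriv_eq (hf : ContDiff ℝ (⊤ : ℕ∞) f) {k : ℕ} (r : Fin k → Fin N) :
    ∃ α : Fin N → ℕ, ∑ i, α i = k ∧ ∀ x,
      iteratedFDeriv ℝ k f x (fun j => EuclideanSpace.single (r j) (1 : ℝ)) =
        partialDeriv α f x := by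
  classical
  let α : Fin N → ℕ := fun i => Fintype.card {j // r j = i}
  let σ : Fin k ≃ Fin (∑ i, α i) := (Equiv.sigmaFiberEquiv r).symm.trans
    ((Equiv.sigmaCongrRight fun i => Fintype.equivFin {j // r j = i}).trans finSigmaFinEquiv)
  have hσ : ∀ j, (finSigmaFinEquiv.symm (σ j)).1 = r j := fun j => by
    simp [σ, Equiv.sigmaFiberEquiv]
  refine ⟨α, by simpa using (Fintype.card_congr σ).symm, fun x => ?_⟩
  unfold partialDeriv
  rw [iteratedFDeriv_eq_dirDeriv hf, iteratedFDeriv_eq_dirDeriv hf]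
  refine congrFun (dirDeriv_perm hf (Multiset.coe_eq_coe.1 ?_)) x
  rw [← Fin.univ_val_map, ← Fin.univ_val_map, ← Multiset.map_univ_val_equiv σ, Multiset.map_map]
  simp only [Function.comp_def, hσ]

theorem norm_partialDeriv_le (α : Fin N → ℕ) (x : EuclideanSpace ℝ (Fin N)) :
    ‖partialDeriv α f x‖ ≤ ‖iteratedFDeriv ℝ (∑ i, α i) f x‖ := by
  refine (ContinuousMultilinearMap.le_opNorm _ _).trans ?_
  simp

theorem norm_iteratedFDeriv_le_sum (k : ℕ) (x : EuclideanSpace ℝ (Fin N)) :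
    ‖iteratedFDeriv ℝ k f x‖ ≤ ∑ r : Fin k → Fin N,
      ‖iteratedFDeriv ℝ k f x (fun j => EuclideanSpace.single (r j) (1 : ℝ))‖ := by
  classical
  refine ContinuousMultilinearMap.opNorm_le_bound (by positivity) fun v => ?_
  have hv : v = fun j => ∑ i, v j i • EuclideanSpace.single i (1 : ℝ) := by
    funext j
    have := (EuclideanSpace.basisFun (Fin N) ℝ).sum_repr (v j)
    simpa using this.symm
  conv_lhs => rw [hv]
  have hsum := (iteratedFDeriv ℝ k f x).toMultilinearMap.map_sum
    (fun (j : Fin k) (i : Fin N) => v j i • EuclideanSpace.single i (1 : ℝ))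
  simp only [ContinuousMultilinearMap.coe_coe] at hsum
  rw [hsum, Finset.sum_mul]
  refine norm_sum_le_of_le _ fun r _ => ?_
  rw [ContinuousMultilinearMap.map_smul_univ, norm_smul, mul_comm, norm_prod]
  refine mul_le_mul_of_nonneg_left ?_ (norm_nonneg _)
  exact Finset.prod_le_prod (fun _ _ => norm_nonneg _) fun j _ => PiLp.norm_apply_le (v j) (r j)

/-- The operator norm is at most the sum over the N^k words of basis directions, each of which is
some ∂^α with |α| = k. -/
theorem enorm_iteratedFDeriv_mul_le (hf : ContDiff ℝ (⊤ : ℕ∞) f) {k : ℕ}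
    {x : EuclideanSpace ℝ (Fin N)} {c P : ℝ≥0∞}
    (h : ∀ α : Fin N → ℕ, ∑ i, α i = k → ‖partialDeriv α f x‖ₑ * c ≤ P) :
    ‖iteratedFDeriv ℝ k f x‖ₑ * c ≤ (N : ℝ≥0∞) ^ k * P := by
  have h1 : ‖iteratedFDeriv ℝ k f x‖ₑ ≤ ∑ r : Fin k → Fin N,
      ‖iteratedFDeriv ℝ k f x (fun j => EuclideanSpace.single (r j) (1 : ℝ))‖ₑ := by
    simp only [← ofReal_norm]
    rw [← ENNReal.ofReal_sum_of_nonneg fun _ _ => norm_nonneg _]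
    exact ENNReal.ofReal_le_ofReal (norm_iteratedFDeriv_le_sum k x)
  refine (mul_le_mul_left h1 c).trans ?_
  rw [Finset.sum_mul]
  refine (Finset.sum_le_sum (g := fun _ => P) fun r _ => ?_).trans (by simp)
  obtain ⟨α, hα, hα'⟩ := exists_partialDeriv_eq hf r
  rw [hα' x]
  exact h α hα

theorem enorm_partialDeriv_le (α : Fin N → ℕ) (x : EuclideanSpace ℝ (Fin N)) :
    ‖partialDeriv α f x‖ₑ ≤ ‖iteratedFDeriv ℝ (∑ i, α i) f x‖ₑ := by
  simp only [← ofReal_norm]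
  exact ENNReal.ofReal_le_ofReal (norm_partialDeriv_le α x)

end PartialDeriv

/-! ### Derivatives of characters and of the Gaussian. -/

section Exponentials

theorem iteratedDeriv_cexp_const_mul_ofReal (c : ℂ) (n : ℕ) :
    (iteratedDeriv n fun t : ℝ => Complex.exp (c * t)) =
      fun t : ℝ => c ^ n * Complex.exp (c * t) := by
  induction n with
  | zero => simp
  | succ n ih =>
    rw [iteratedDeriv_succ, ih]
    funext t
    have h1 : HasDerivAt (fun t : ℝ => c * (t : ℂ)) c t := by
      simpa using (Complex.ofRealCLM.hasDerivAt (x := t)).const_mul c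
    rw [(h1.cexp.const_mul (c ^ n)).deriv]
    ring

theorem norm_iteratedFDeriv_cexp_const_mul (c : ℂ) (n : ℕ) (t : ℝ) :
    ‖iteratedFDeriv ℝ n (fun t : ℝ => Complex.exp (c * t)) t‖ =
      ‖c‖ ^ n * ‖Complex.exp (c * t)‖ := by
  rw [norm_iteratedFDeriv_eq_norm_iteratedDeriv, iteratedDeriv_cexp_const_mul_ofReal, norm_mul,
    norm_pow]

theorem contDiff_cexp_const_mul (c : ℂ) :
    ContDiff ℝ (⊤ : ℕ∞) fun t : ℝ => Complex.exp (c * t) :=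
  (contDiff_const.mul Complex.ofRealCLM.contDiff).cexp

variable {E : Type*} [NormedAddCommGroup E] [InnerProductSpace ℝ E]

theorem contDiff_character (y : E) :
    ContDiff ℝ (⊤ : ℕ∞) fun ξ : E => Complex.exp (-(Complex.I * ((inner ℝ y ξ : ℝ) : ℂ))) := by
  have h := (contDiff_cexp_const_mul (-Complex.I)).comp (innerSL ℝ y).contDiff
  simpa [Function.comp_def] using h

theorem norm_iteratedFDeriv_character_le (y : E) (k : ℕ) (ξ : E) :
    ‖iteratedFDeriv ℝ k (fun ξ : E => Complex.exp (-(Complex.I * ((inner ℝ y ξ : ℝ) : ℂ)))) ξ‖ ≤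
      ‖y‖ ^ k := by
  have h : (fun ξ : E => Complex.exp (-(Complex.I * ((inner ℝ y ξ : ℝ) : ℂ)))) =
      (fun t : ℝ => Complex.exp (-Complex.I * t)) ∘ (innerSL ℝ y) := by
    funext ξ
    simp
  rw [h, (innerSL ℝ y).iteratedFDeriv_comp_right (contDiff_cexp_const_mul _) ξ
    (i := k) (by exact_mod_cast le_top)]
  refine (ContinuousMultilinearMap.norm_compContinuousLinearMap_le _ _).trans ?_
  rw [norm_iteratedFDeriv_cexp_const_mul, neg_mul, mul_comm Complex.I, ← neg_mul,
    ← Complex.ofReal_neg, Complex.norm_exp_ofReal_mul_I]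
  simp

theorem norm_iteratedFDeriv_id_le (k : ℕ) (x : E) :
    ‖iteratedFDeriv ℝ k (fun y : E => y) x‖ ≤ 1 + ‖x‖ := by
  rcases k with _ | k
  · simp
  · rw [← norm_iteratedFDeriv_fderiv]
    have : fderiv ℝ (fun y : E => y) = fun _ => ContinuousLinearMap.id ℝ E := by
      funext y
      exact fderiv_fun_id
    rw [this]
    rcases k with _ | k
    · rw [norm_iteratedFDeriv_zero]
      exact ContinuousLinearMap.norm_id_le.trans (by linarith [norm_nonneg x])
    · rw [iteratedFDeriv_succ_const]
      simp only [Pi.zero_apply, norm_zero]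
      positivity

/-- A crude bound of the form D^k, as the estimate for derivatives of a composition requires of the
inner function. -/
theorem norm_iteratedFDeriv_norm_sq_le {k : ℕ} (hk : 1 ≤ k) (x : E) :
    ‖iteratedFDeriv ℝ k (fun y : E => ‖y‖ ^ 2) x‖ ≤ (2 * (1 + ‖x‖) ^ 2) ^ k := by
  have h : (fun y : E => ‖y‖ ^ 2) = fun y => innerSL ℝ y y := by
    funext y
    simp [innerSL_apply_apply]
  rw [h]
  have hx := norm_nonneg x
  refine ((innerSL ℝ).norm_iteratedFDeriv_le_of_bilinear (contDiff_id (n := ((⊤ : ℕ∞) : WithTop ℕ∞)))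
    (contDiff_id (n := ((⊤ : ℕ∞) : WithTop ℕ∞))) x (n := k) (by exact_mod_cast le_top)).trans ?_
  have h1 : ∑ i ∈ Finset.range (k + 1), (k.choose i : ℝ) * ‖iteratedFDeriv ℝ i (fun y : E => y) x‖ *
      ‖iteratedFDeriv ℝ (k - i) (fun y : E => y) x‖ ≤ 2 ^ k * (1 + ‖x‖) ^ 2 := by
    rw [← (by exact_mod_cast Nat.sum_range_choose k :
      ∑ i ∈ Finset.range (k + 1), (k.choose i : ℝ) = 2 ^ k), Finset.sum_mul]
    refine Finset.sum_le_sum fun i _ => ?_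
    rw [mul_assoc, sq]
    exact mul_le_mul_of_nonneg_left (mul_le_mul (norm_iteratedFDeriv_id_le _ _)
      (norm_iteratedFDeriv_id_le _ _) (norm_nonneg _) (by positivity)) (by positivity)
  have h2 : ‖innerSL ℝ (E := E)‖ ≤ 1 := norm_innerSL_le ℝ
  refine (mul_le_mul h2 h1 (by positivity) zero_le_one).trans ?_
  rw [one_mul, mul_pow]
  refine mul_le_mul_of_nonneg_left ?_ (by positivity)
  exact le_self_pow₀ (one_le_pow₀ (by linarith)) (by omega)

/-- The Gaussian `exp (-|x|²/2)`. -/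
noncomputable def gauss (x : E) : ℂ := Complex.exp (-(1 / 2) * (((‖x‖ ^ 2 : ℝ)) : ℂ))

theorem contDiff_gauss : ContDiff ℝ (⊤ : ℕ∞) (gauss : E → ℂ) :=
  (contDiff_cexp_const_mul (-(1 / 2))).comp (contDiff_norm_sq ℝ)

theorem gauss_eq_ofReal {F : Type*} [NormedAddCommGroup F] (x : F) : gauss x = ((Real.exp (-(‖x‖ ^ 2 / 2)) : ℝ) : ℂ) := by
  rw [gauss, Complex.ofReal_exp]
  congr 1
  push_cast
  ring

theorem norm_iteratedFDeriv_gauss_le (k : ℕ) (x : E) :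
    ‖iteratedFDeriv ℝ k (gauss : E → ℂ) x‖ ≤
      k.factorial * Real.exp (-(‖x‖ ^ 2 / 2)) * (2 * (1 + ‖x‖) ^ 2) ^ k := by
  refine norm_iteratedFDeriv_comp_le (contDiff_cexp_const_mul (-(1 / 2))) (contDiff_norm_sq ℝ)
    (n := k) (by exact_mod_cast le_top) x (fun i _ => ?_)
    (fun i hi _ => norm_iteratedFDeriv_norm_sq_le hi x)
  rw [norm_iteratedFDeriv_cexp_const_mul]
  have h1 : ‖Complex.exp (-(1 / 2) * (((‖x‖ ^ 2 : ℝ)) : ℂ))‖ = Real.exp (-(‖x‖ ^ 2 / 2)) := by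
    have := gauss_eq_ofReal x
    rw [gauss] at this
    rw [this, Complex.norm_real, Real.norm_of_nonneg (Real.exp_pos _).le]
  rw [h1]
  refine mul_le_of_le_one_left (Real.exp_pos _).le (pow_le_one₀ (norm_nonneg _) ?_)
  norm_num

end Exponentials

/-! ### Rapidly decreasing functions and their Fourier transforms. -/

section Rapid

variable {N : ℕ} (ω : NQWeight)

/-- Smooth functions all of whose derivatives decay faster than `exp (-λ ω)` for every `λ`. -/
structure IsRapid (f : EuclideanSpace ℝ (Fin N) → ℂ) : Prop where
  contDiff : ContDiff ℝ (⊤ : ℕ∞) f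
  bound : ∀ (k : ℕ) (lam : ℝ), 0 ≤ lam →
    ∃ C : ℝ, ∀ x, Real.exp (lam * ω ‖x‖) * ‖iteratedFDeriv ℝ k f x‖ ≤ C

variable {ω}

theorem IsRapid.integrable {f : EuclideanSpace ℝ (Fin N) → ℂ} (hf : IsRapid ω f) :
    Integrable f volume := by
  obtain ⟨A, hA0, hA⟩ := ω.exists_one_add_pow_le
  obtain ⟨C, hC⟩ := hf.bound 0 ((N + 1 : ℕ) * A) (by positivity)
  have hint : Integrable (fun x : EuclideanSpace ℝ (Fin N) => (1 + ‖x‖) ^ (-((N + 1 : ℕ) : ℝ)))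
      volume := integrable_one_add_norm (by simp)
  refine (hint.const_mul (Real.exp ((N + 1 : ℕ) * A) * C)).mono'
    hf.contDiff.continuous.aestronglyMeasurable (Filter.Eventually.of_forall fun x => ?_)
  have h1 := hC x
  have h2 := hA ‖x‖ (norm_nonneg x) (N + 1)
  have hx : 0 < (1 + ‖x‖) := by positivity
  rw [norm_iteratedFDeriv_zero] at h1
  rw [Real.rpow_neg hx.le, Real.rpow_natCast, ← div_eq_mul_inv, le_div_iff₀ (by positivity)]
  calc ‖f x‖ * (1 + ‖x‖) ^ (N + 1)
      ≤ ‖f x‖ * Real.exp ((N + 1 : ℕ) * A * (1 + ω ‖x‖)) :=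
        mul_le_mul_of_nonneg_left h2 (norm_nonneg _)
    _ = Real.exp ((N + 1 : ℕ) * A) * (Real.exp ((N + 1 : ℕ) * A * ω ‖x‖) * ‖f x‖) := by
        rw [mul_add, mul_one, Real.exp_add]
        ring
    _ ≤ _ := mul_le_mul_of_nonneg_left h1 (Real.exp_pos _).le

theorem IsRapid.memS {f : EuclideanSpace ℝ (Fin N) → ℂ} (hf : IsRapid ω f)
    (hf' : IsRapid ω (fourierHat f)) : MemS ω f where
  integrable := hf.integrable
  contDiff := hf.contDiff
  contDiff_hat := hf'.contDiff
  bound lam hlam α := by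
    obtain ⟨C, hC⟩ := hf.bound (∑ i, α i) lam hlam.le
    exact ⟨C, fun x => (mul_le_mul_of_nonneg_left (norm_partialDeriv_le α x)
      (Real.exp_pos _).le).trans (hC x)⟩
  bound_hat lam hlam α := by
    obtain ⟨C, hC⟩ := hf'.bound (∑ i, α i) lam hlam.le
    exact ⟨C, fun x => (mul_le_mul_of_nonneg_left (norm_partialDeriv_le α x)
      (Real.exp_pos _).le).trans (hC x)⟩

theorem IsRapid.tsum {f : ℕ → EuclideanSpace ℝ (Fin N) → ℂ}
    (hf : ∀ n, ContDiff ℝ (⊤ : ℕ∞) (f n))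
    (hB : ∀ k lam, 0 ≤ lam → ∃ B : ℕ → ℝ, Summable B ∧ ∀ n x,
      Real.exp (lam * ω ‖x‖) * ‖iteratedFDeriv ℝ k (f n) x‖ ≤ B n) :
    IsRapid ω fun x => ∑' n, f n x := by
  choose v hv hfv using fun k => hB k 0 le_rfl
  have h0 : ∀ (k : ℕ) (i : ℕ) (x : EuclideanSpace ℝ (Fin N)), (k : ℕ∞) ≤ ⊤ →
      ‖iteratedFDeriv ℝ k (f i) x‖ ≤ v k i := fun k i x _ => by
    simpa using hfv k i x
  refine ⟨contDiff_tsum hf (fun k _ => hv k) h0, fun k lam hlam => ?_⟩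
  obtain ⟨B, hBs, hBf⟩ := hB k lam hlam
  refine ⟨∑' n, B n, fun x => ?_⟩
  rw [iteratedFDeriv_tsum hf (fun k _ => hv k) h0 (k := k) le_top]
  have hs : Summable fun n => Real.exp (lam * ω ‖x‖) * ‖iteratedFDeriv ℝ k (f n) x‖ :=
    Summable.of_nonneg_of_le (fun n => by positivity) (fun n => hBf n x) hBs
  have hs' : Summable fun n => ‖iteratedFDeriv ℝ k (f n) x‖ :=
    Summable.of_nonneg_of_le (fun n => norm_nonneg _) (fun n => h0 k n x le_top) (hv k)
  calc _ ≤ Real.exp (lam * ω ‖x‖) * ∑' n, ‖iteratedFDeriv ℝ k (f n) x‖ :=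
        mul_le_mul_of_nonneg_left (norm_tsum_le_tsum_norm hs') (Real.exp_pos _).le
    _ = ∑' n, Real.exp (lam * ω ‖x‖) * ‖iteratedFDeriv ℝ k (f n) x‖ := tsum_mul_left.symm
    _ ≤ _ := hs.tsum_le_tsum (fun n => hBf n x) hBs

theorem IsRapid.const_smul {f : EuclideanSpace ℝ (Fin N) → ℂ} (hf : IsRapid ω f) (c : ℂ) :
    IsRapid ω fun x => c * f x := by
  refine ⟨contDiff_const.mul hf.contDiff, fun k lam hlam => ?_⟩
  obtain ⟨C, hC⟩ := hf.bound k lam hlam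
  refine ⟨‖c‖ * C, fun x => ?_⟩
  change _ * ‖iteratedFDeriv ℝ k (c • f) x‖ ≤ _
  rw [iteratedFDeriv_const_smul_apply (hf.contDiff.of_le (by exact_mod_cast le_top)).contDiffAt,
    norm_smul, mul_left_comm]
  exact mul_le_mul_of_nonneg_left (hC x) (norm_nonneg c)

/-- The weight grows at most linearly, so the quadratic exponent wins. -/
theorem isRapid_gauss : IsRapid ω (gauss : EuclideanSpace ℝ (Fin N) → ℂ) := by
  refine ⟨contDiff_gauss, fun k lam hlam => ?_⟩
  obtain ⟨B, hB0, hB⟩ := ω.exists_le_linear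
  refine ⟨k.factorial * 2 ^ k * Real.exp (lam * B + (lam * B + 2 * k) ^ 2 / 2), fun x => ?_⟩
  have hx := norm_nonneg x
  have h1 : (1 + ‖x‖) ^ (2 * k) ≤ Real.exp (2 * k * ‖x‖) := by
    have := pow_le_pow_left₀ (by positivity) (by linarith [Real.add_one_le_exp ‖x‖] :
      1 + ‖x‖ ≤ Real.exp ‖x‖) (2 * k)
    rw [← Real.exp_nat_mul] at this
    exact_mod_cast this
  have h2 : Real.exp (lam * ω ‖x‖) ≤ Real.exp (lam * (B * (1 + ‖x‖))) :=
    Real.exp_le_exp.2 (mul_le_mul_of_nonneg_left (hB _ hx) hlam)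
  calc _ ≤ Real.exp (lam * (B * (1 + ‖x‖))) *
        (k.factorial * Real.exp (-(‖x‖ ^ 2 / 2)) * (2 * (1 + ‖x‖) ^ 2) ^ k) :=
        mul_le_mul h2 (norm_iteratedFDeriv_gauss_le k x) (norm_nonneg _) (Real.exp_pos _).le
    _ = k.factorial * 2 ^ k * (Real.exp (lam * (B * (1 + ‖x‖))) * Real.exp (-(‖x‖ ^ 2 / 2)) *
        (1 + ‖x‖) ^ (2 * k)) := by
        rw [mul_pow, pow_mul]
        ring
    _ ≤ k.factorial * 2 ^ k * (Real.exp (lam * (B * (1 + ‖x‖))) * Real.exp (-(‖x‖ ^ 2 / 2)) *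
        Real.exp (2 * k * ‖x‖)) := by gcongr
    _ ≤ _ := by
        rw [← Real.exp_add, ← Real.exp_add]
        refine mul_le_mul_of_nonneg_left (Real.exp_le_exp.2 ?_) (by positivity)
        -- Completing the square in ‖x‖ produces the constant chosen above.
        nlinarith [sq_nonneg (‖x‖ - (lam * B + 2 * k))]

theorem fourierHat_gauss : ∃ c : ℂ, (fourierHat (gauss : EuclideanSpace ℝ (Fin N) → ℂ)) =
    fun ξ => c * gauss ξ := by
  refine ⟨(Real.pi / (1 / 2 : ℂ)) ^ ((Module.finrank ℝ (EuclideanSpace ℝ (Fin N)) : ℂ) / 2), ?_⟩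
  funext ξ
  have h := GaussianFourier.integral_cexp_neg_mul_sq_norm_add (b := 1 / 2)
    (V := EuclideanSpace ℝ (Fin N)) (by norm_num) (-Complex.I) ξ
  unfold fourierHat
  convert h using 2
  · funext x
    rw [gauss, ← Complex.exp_add, real_inner_comm]
    congr 1
    push_cast
    ring
  · rw [gauss]
    congr 1
    rw [neg_sq, Complex.I_sq]
    push_cast
    ring

theorem fourierHat_comp_sub (f : EuclideanSpace ℝ (Fin N) → ℂ) (y ξ : EuclideanSpace ℝ (Fin N)) :
    fourierHat (fun x => f (x - y)) ξ =
      Complex.exp (-(Complex.I * ((inner ℝ y ξ : ℝ) : ℂ))) * fourierHat f ξ := by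
  unfold fourierHat
  rw [← integral_sub_right_eq_self (fun x => f x *
    Complex.exp (-(Complex.I * ((inner ℝ x ξ : ℝ) : ℂ)))) y, ← integral_const_mul]
  refine integral_congr_ae (Filter.Eventually.of_forall fun x => ?_)
  simp only
  rw [mul_left_comm, ← Complex.exp_add]
  congr 2
  rw [inner_sub_left]
  push_cast
  ring

end Rapid

/-! ### Members of S_ω with slow decay along a sequence. -/

section SumOfTranslates

variable {N : ℕ} {ω : NQWeight}

theorem summable_exp_sub_mul {w : ℕ → ℝ} (hw : ∀ n : ℕ, (n : ℝ) ≤ w n) (A : ℝ) :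
    Summable fun n : ℕ => Real.exp ((A - n) * w n) := by
  refine Real.summable_exp_neg_nat.of_norm_bounded_eventually_nat ?_
  obtain ⟨n₀, hn₀⟩ := exists_nat_ge (A + 1)
  filter_upwards [Filter.eventually_ge_atTop n₀] with n hn
  rw [Real.norm_of_nonneg (Real.exp_pos _).le, Real.exp_le_exp]
  have h1 : (n₀ : ℝ) ≤ n := by exact_mod_cast hn
  have h2 := hw n
  have h3 : (0 : ℝ) ≤ n := Nat.cast_nonneg n
  nlinarith

theorem contDiff_translate {f : EuclideanSpace ℝ (Fin N) → ℂ} (hf : ContDiff ℝ (⊤ : ℕ∞) f)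
    (c : ℂ) (y : EuclideanSpace ℝ (Fin N)) :
    ContDiff ℝ (⊤ : ℕ∞) fun x => c * f (x - y) :=
  contDiff_const.mul (hf.comp (contDiff_id.sub contDiff_const))

/-- Since ω(y) ≤ K (1 + ω(y - x_n) + ω(x_n)), translating by x_n costs exp(λ K ω(x_n)). The
coefficient absorbs it once n exceeds λ K, and ω(x_n) ≥ n makes the rest summable. -/
theorem isRapid_tsum_translates {f : EuclideanSpace ℝ (Fin N) → ℂ} (hf : IsRapid ω f)
    {x : ℕ → EuclideanSpace ℝ (Fin N)} (hx : ∀ n : ℕ, (n : ℝ) ≤ ω ‖x n‖) :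
    IsRapid ω fun y => ∑' n : ℕ, (Real.exp (-(n * ω ‖x n‖)) : ℂ) * f (y - x n) := by
  refine IsRapid.tsum (fun n => contDiff_translate hf.contDiff _ _) fun k lam hlam => ?_
  obtain ⟨K, hK0, hK⟩ := ω.exists_add_le
  obtain ⟨C, hC⟩ := hf.bound k (lam * K) (by positivity)
  refine ⟨fun n => Real.exp (lam * K) * C * Real.exp ((lam * K - n) * ω ‖x n‖),
    (summable_exp_sub_mul hx _).mul_left _, fun n y => ?_⟩
  have h1 : iteratedFDeriv ℝ k (fun y => (Real.exp (-(n * ω ‖x n‖)) : ℂ) * f (y - x n)) y =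
      (Real.exp (-(n * ω ‖x n‖)) : ℂ) • iteratedFDeriv ℝ k f (y - x n) := by
    change iteratedFDeriv ℝ k ((Real.exp (-(n * ω ‖x n‖)) : ℂ) • fun y => f (y - x n)) y = _
    rw [iteratedFDeriv_const_smul_apply, iteratedFDeriv_comp_sub]
    exact ((hf.contDiff.of_le (by exact_mod_cast le_top)).comp
      (contDiff_id.sub contDiff_const)).contDiffAt
  have h2 : ω ‖y‖ ≤ K * (1 + ω ‖y - x n‖ + ω ‖x n‖) :=
    (ω.mono (norm_nonneg y) (by simpa using norm_add_le (y - x n) (x n))).trans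
      (hK _ _ (norm_nonneg _) (norm_nonneg _))
  rw [h1, norm_smul, Complex.norm_real, Real.norm_of_nonneg (Real.exp_pos _).le]
  calc _ ≤ Real.exp (lam * (K * (1 + ω ‖y - x n‖ + ω ‖x n‖))) *
        (Real.exp (-(n * ω ‖x n‖)) * ‖iteratedFDeriv ℝ k f (y - x n)‖) := by
        gcongr
    _ = Real.exp (lam * K) * (Real.exp (lam * K * ω ‖y - x n‖) *
        ‖iteratedFDeriv ℝ k f (y - x n)‖) * Real.exp ((lam * K - n) * ω ‖x n‖) := by
        have : lam * (K * (1 + ω ‖y - x n‖ + ω ‖x n‖)) = lam * K + lam * K * ω ‖y - x n‖ +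
            ((lam * K - n) * ω ‖x n‖ + n * ω ‖x n‖) := by ring
        rw [this, Real.exp_add, Real.exp_add, Real.exp_add, Real.exp_neg]
        field_simp
    _ ≤ _ := by
        exact mul_le_mul_of_nonneg_right (mul_le_mul_of_nonneg_left (hC (y - x n))
          (Real.exp_pos _).le) (Real.exp_pos _).le

/-- The Fourier side of the sum of translates. Differentiating the characters up to order k costs (1
+ |x_n|)^k, hence at most exp(k A (1 + ω(x_n))), again absorbed by the coefficients. -/
theorem isRapid_tsum_modulations {f : EuclideanSpace ℝ (Fin N) → ℂ} (hf : IsRapid ω f)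
    {x : ℕ → EuclideanSpace ℝ (Fin N)} (hx : ∀ n : ℕ, (n : ℝ) ≤ ω ‖x n‖) :
    IsRapid ω fun ξ => ∑' n : ℕ, (Real.exp (-(n * ω ‖x n‖)) : ℂ) *
      (Complex.exp (-(Complex.I * ((inner ℝ (x n) ξ : ℝ) : ℂ))) * f ξ) := by
  have hsm : ∀ n, ContDiff ℝ (⊤ : ℕ∞) fun ξ =>
      Complex.exp (-(Complex.I * ((inner ℝ (x n) ξ : ℝ) : ℂ))) * f ξ :=
    fun n => (contDiff_character (x n)).mul hf.contDiff
  refine IsRapid.tsum (fun n => contDiff_const.mul (hsm n)) fun k lam hlam => ?_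
  obtain ⟨A, hA0, hA⟩ := ω.exists_one_add_pow_le
  choose C hC using fun j => hf.bound j lam hlam
  have hC0 : ∀ j, 0 ≤ C j := fun j => (by positivity : (0 : ℝ) ≤ _).trans (hC j 0)
  set D : ℝ := ∑ i ∈ Finset.range (k + 1), (k.choose i : ℝ) * C (k - i) with hD
  have hD0 : 0 ≤ D := Finset.sum_nonneg fun i _ => mul_nonneg (Nat.cast_nonneg _) (hC0 _)
  refine ⟨fun n => Real.exp (k * A) * D * Real.exp ((k * A - n) * ω ‖x n‖),
    (summable_exp_sub_mul hx _).mul_left _, fun n ξ => ?_⟩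
  have h1 : iteratedFDeriv ℝ k (fun ξ => (Real.exp (-(n * ω ‖x n‖)) : ℂ) *
      (Complex.exp (-(Complex.I * ((inner ℝ (x n) ξ : ℝ) : ℂ))) * f ξ)) ξ =
      (Real.exp (-(n * ω ‖x n‖)) : ℂ) • iteratedFDeriv ℝ k (fun ξ =>
        Complex.exp (-(Complex.I * ((inner ℝ (x n) ξ : ℝ) : ℂ))) * f ξ) ξ := by
    rw [← iteratedFDeriv_const_smul_apply ((hsm n).of_le (by exact_mod_cast le_top)).contDiffAt]
    rfl
  have h2 : Real.exp (lam * ω ‖ξ‖) * ‖iteratedFDeriv ℝ k (fun ξ =>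
      Complex.exp (-(Complex.I * ((inner ℝ (x n) ξ : ℝ) : ℂ))) * f ξ) ξ‖ ≤
      (1 + ‖x n‖) ^ k * D := by
    refine (mul_le_mul_of_nonneg_left (norm_iteratedFDeriv_mul_le (contDiff_character (x n))
      hf.contDiff ξ (n := k) (by exact_mod_cast le_top)) (Real.exp_pos _).le).trans ?_
    rw [Finset.mul_sum, hD, Finset.mul_sum]
    refine Finset.sum_le_sum fun i hi => ?_
    have h3 : ‖iteratedFDeriv ℝ i (fun ξ =>
        Complex.exp (-(Complex.I * ((inner ℝ (x n) ξ : ℝ) : ℂ)))) ξ‖ ≤ (1 + ‖x n‖) ^ k :=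
      ((norm_iteratedFDeriv_character_le _ _ _).trans
        (pow_le_pow_left₀ (norm_nonneg _) (by linarith) i)).trans
        (pow_le_pow_right₀ (by linarith [norm_nonneg (x n)]) (by simpa [Nat.lt_succ_iff] using hi))
    calc _ = (k.choose i : ℝ) * (‖iteratedFDeriv ℝ i (fun ξ =>
          Complex.exp (-(Complex.I * ((inner ℝ (x n) ξ : ℝ) : ℂ)))) ξ‖ *
          (Real.exp (lam * ω ‖ξ‖) * ‖iteratedFDeriv ℝ (k - i) f ξ‖)) := by ring
      _ ≤ (k.choose i : ℝ) * ((1 + ‖x n‖) ^ k * C (k - i)) :=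
          mul_le_mul_of_nonneg_left (mul_le_mul h3 (hC _ _) (by positivity) (by positivity))
            (Nat.cast_nonneg _)
      _ = _ := by ring
  rw [h1, norm_smul, Complex.norm_real, Real.norm_of_nonneg (Real.exp_pos _).le, mul_left_comm]
  calc _ ≤ Real.exp (-(n * ω ‖x n‖)) * (Real.exp (k * A * (1 + ω ‖x n‖)) * D) :=
        mul_le_mul_of_nonneg_left (h2.trans (mul_le_mul_of_nonneg_right
          (hA _ (norm_nonneg _) k) hD0)) (Real.exp_pos _).le
    _ = _ := by
        have : (k : ℝ) * A * (1 + ω ‖x n‖) = k * A + ((k * A - n) * ω ‖x n‖ + n * ω ‖x n‖) := by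
          ring
        rw [this, Real.exp_add, Real.exp_add, Real.exp_neg]
        field_simp

theorem fourierHat_tsum_translates {f : EuclideanSpace ℝ (Fin N) → ℂ} (hf : Integrable f volume)
    {c : ℕ → ℝ} (hc0 : ∀ n, 0 ≤ c n) (hc : Summable c) (x : ℕ → EuclideanSpace ℝ (Fin N)) :
    fourierHat (fun y => ∑' n : ℕ, (c n : ℂ) * f (y - x n)) = fun ξ =>
      ∑' n : ℕ, (c n : ℂ) *
        (Complex.exp (-(Complex.I * ((inner ℝ (x n) ξ : ℝ) : ℂ))) * fourierHat f ξ) := by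
  funext ξ
  set F : ℕ → EuclideanSpace ℝ (Fin N) → ℂ := fun n y =>
    (c n : ℂ) * (f (y - x n) * Complex.exp (-(Complex.I * ((inner ℝ y ξ : ℝ) : ℂ)))) with hF
  have hchar : ∀ y : EuclideanSpace ℝ (Fin N),
      ‖Complex.exp (-(Complex.I * ((inner ℝ y ξ : ℝ) : ℂ)))‖ = 1 := fun y => by
    rw [mul_comm, ← neg_mul, ← Complex.ofReal_neg, Complex.norm_exp_ofReal_mul_I]
  have hnorm : ∀ n y, ‖F n y‖ = c n * ‖f (y - x n)‖ := fun n y => by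
    simp only [hF, norm_mul, hchar, mul_one, Complex.norm_real, Real.norm_of_nonneg (hc0 n)]
  have hint : ∀ n, Integrable (F n) volume := fun n => by
    refine Integrable.const_mul ?_ _
    refine (hf.comp_sub_right (x n)).mul_bdd (c := 1) ?_
      (Filter.Eventually.of_forall fun y => (hchar y).le)
    exact (by fun_prop : Continuous fun y : EuclideanSpace ℝ (Fin N) =>
      Complex.exp (-(Complex.I * ((inner ℝ y ξ : ℝ) : ℂ)))).aestronglyMeasurable
  have hsum : Summable fun n => ∫ y, ‖F n y‖ := by
    simp only [hnorm, integral_const_mul]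
    have : ∀ n, ∫ y, ‖f (y - x n)‖ = ∫ y, ‖f y‖ := fun n =>
      integral_sub_right_eq_self (fun y => ‖f y‖) (x n)
    simp only [this]
    exact hc.mul_right _
  have key := (hasSum_integral_of_summable_integral_norm hint hsum).tsum_eq
  unfold fourierHat at *
  calc _ = ∫ y, ∑' n, F n y := by
        refine integral_congr_ae (Filter.Eventually.of_forall fun y => ?_)
        simp only [hF]
        rw [← tsum_mul_right]
        exact tsum_congr fun n => mul_assoc _ _ _
    _ = ∑' n, ∫ y, F n y := key.symm
    _ = _ := by
        refine tsum_congr fun n => ?_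
        simp only [hF]
        rw [integral_const_mul]
        exact congrArg _ (fourierHat_comp_sub f (x n) ξ)

theorem isRapid_fourierHat_gauss :
    IsRapid ω (fourierHat (gauss : EuclideanSpace ℝ (Fin N) → ℂ)) := by
  obtain ⟨c, hc⟩ := fourierHat_gauss (N := N)
  rw [hc]
  exact isRapid_gauss.const_smul c

theorem memS_gauss : MemS ω (gauss : EuclideanSpace ℝ (Fin N) → ℂ) :=
  isRapid_gauss.memS isRapid_fourierHat_gauss

/-- A member of `S_ω` that decays no faster than `exp (-n ω)` at the `n`-th point of a sequence
going to infinity. -/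
theorem exists_memS_ge {x : ℕ → EuclideanSpace ℝ (Fin N)} (hx : ∀ n : ℕ, (n : ℝ) ≤ ω ‖x n‖) :
    ∃ g, MemS ω g ∧ ∀ n : ℕ, Real.exp (-(n * ω ‖x n‖)) ≤ ‖g (x n)‖ := by
  have hc : Summable fun n : ℕ => Real.exp (-(n * ω ‖x n‖)) := by
    simpa using summable_exp_sub_mul hx 0
  have hle : ∀ z : EuclideanSpace ℝ (Fin N), Real.exp (-(‖z‖ ^ 2 / 2)) ≤ 1 := fun z =>
    Real.exp_le_one_iff.2 (by have := sq_nonneg ‖z‖; linarith)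
  have hreal : ∀ y, Summable fun n : ℕ =>
      Real.exp (-(n * ω ‖x n‖)) * Real.exp (-(‖y - x n‖ ^ 2 / 2)) := fun y =>
    Summable.of_nonneg_of_le (fun n => by positivity)
      (fun n => mul_le_of_le_one_right (Real.exp_pos _).le (hle _)) hc
  refine ⟨fun y => ∑' n : ℕ, (Real.exp (-(n * ω ‖x n‖)) : ℂ) * gauss (y - x n),
    (isRapid_tsum_translates isRapid_gauss hx).memS ?_, fun n => ?_⟩
  · rw [fourierHat_tsum_translates (isRapid_gauss (ω := ω)).integrable
      (fun n => (Real.exp_pos _).le) hc x]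
    exact isRapid_tsum_modulations isRapid_fourierHat_gauss hx
  · have h1 : ∑' j : ℕ, (Real.exp (-(j * ω ‖x j‖)) : ℂ) * gauss (x n - x j) =
        ((∑' j : ℕ, Real.exp (-(j * ω ‖x j‖)) * Real.exp (-(‖x n - x j‖ ^ 2 / 2)) : ℝ) : ℂ) := by
      simp only [gauss_eq_ofReal]
      rw [Complex.ofReal_tsum]
      push_cast
      rfl
    -- All summands are positive, so the sum at x_n is at least its n-th term, where the Gaussian
    -- equals 1.
    have h2 := (hreal (x n)).le_tsum n fun j _ => by positivity
    simp only
    rw [h1, Complex.norm_real]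
    refine le_trans ?_ (le_abs_self _)
    simpa using h2

end SumOfTranslates

/-! ### Infinite iterated averages on the line. -/

section Averaging

/-- The average of `f` over `[x - a, x]`. -/
noncomputable def leftAverage (a : ℝ) (f : ℝ → ℂ) (x : ℝ) : ℂ :=
  (a⁻¹ : ℂ) * ∫ y in (x - a)..x, f y

variable {a : ℝ} {f : ℝ → ℂ}

theorem hasDerivAt_average (hf : Continuous f) (x : ℝ) :
    HasDerivAt (leftAverage a f) ((a⁻¹ : ℂ) * (f x - f (x - a))) x := by
  have hi : ∀ u v : ℝ, IntervalIntegrable f volume u v := fun u v => hf.intervalIntegrable u v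
  have h1 : ∀ z, HasDerivAt (fun u => ∫ y in (0 : ℝ)..u, f y) (f z) z := fun z =>
    intervalIntegral.integral_hasDerivAt_right (hi 0 z)
      hf.aestronglyMeasurable.stronglyMeasurableAtFilter hf.continuousAt
  have h2 : HasDerivAt (fun u => ∫ y in (0 : ℝ)..(u - a), f y) (f (x - a)) x := by
    have := (h1 (x - a)).scomp x ((hasDerivAt_id x).sub_const a)
    simpa [Function.comp_def] using this
  have h3 : leftAverage a f = fun x => (a⁻¹ : ℂ) *
      ((∫ y in (0 : ℝ)..x, f y) - ∫ y in (0 : ℝ)..(x - a), f y) := by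
    funext u
    rw [leftAverage, intervalIntegral.integral_interval_sub_left (hi 0 u) (hi 0 (u - a))]
  rw [h3]
  exact ((h1 x).sub h2).const_mul _

theorem contDiff_average (hf : ContDiff ℝ (⊤ : ℕ∞) f) : ContDiff ℝ (⊤ : ℕ∞) (leftAverage a f) := by
  rw [contDiff_infty_iff_deriv]
  refine ⟨fun x => (hasDerivAt_average hf.continuous x).differentiableAt, ?_⟩
  have : deriv (leftAverage a f) = fun x => (a⁻¹ : ℂ) * (f x - f (x - a)) :=
    funext fun x => (hasDerivAt_average hf.continuous x).deriv
  rw [this]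
  exact contDiff_const.mul (hf.sub (hf.comp (contDiff_id.sub contDiff_const)))

theorem deriv_average (hf : ContDiff ℝ (⊤ : ℕ∞) f) :
    deriv (leftAverage a f) = leftAverage a (deriv f) := by
  funext x
  rw [(hasDerivAt_average hf.continuous x).deriv, leftAverage,
    intervalIntegral.integral_deriv_eq_sub (fun y _ => (hf.differentiable (by simp)) y)
      ((contDiff_infty_iff_deriv.1 hf).2.continuous.intervalIntegrable _ _)]

theorem contDiff_iteratedDeriv_top (hf : ContDiff ℝ (⊤ : ℕ∞) f) (j : ℕ) :
    ContDiff ℝ (⊤ : ℕ∞) (iteratedDeriv j f) := by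
  rw [iteratedDeriv_eq_iterate]
  exact hf.iterate_deriv j

theorem iteratedDeriv_average (hf : ContDiff ℝ (⊤ : ℕ∞) f) (j : ℕ) :
    iteratedDeriv j (leftAverage a f) = leftAverage a (iteratedDeriv j f) := by
  induction j generalizing f with
  | zero => simp
  | succ j ih =>
    rw [iteratedDeriv_succ', iteratedDeriv_succ', deriv_average hf,
      ih (contDiff_infty_iff_deriv.1 hf).2]

theorem norm_average_le (ha : 0 < a) {C : ℝ} (hC : ∀ x, ‖f x‖ ≤ C) (x : ℝ) :
    ‖leftAverage a f x‖ ≤ C := by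
  have h := intervalIntegral.norm_integral_le_of_norm_le_const (a := x - a) (b := x)
    (f := f) (C := C) fun y _ => hC y
  rw [sub_sub_cancel, abs_of_pos ha] at h
  rw [leftAverage, norm_mul, norm_inv, Complex.norm_real, Real.norm_of_nonneg ha.le,
    inv_mul_le_iff₀ ha]
  linarith

theorem norm_deriv_average_le (ha : 0 < a) (hf : Continuous f) {C : ℝ} (hC : ∀ x, ‖f x‖ ≤ C)
    (x : ℝ) : ‖deriv (leftAverage a f) x‖ ≤ 2 / a * C := by
  rw [(hasDerivAt_average hf x).deriv, norm_mul, norm_inv, Complex.norm_real,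
    Real.norm_of_nonneg ha.le, inv_mul_le_iff₀ ha]
  have : a * (2 / a * C) = C + C := by
    field_simp
    ring
  rw [this]
  exact (norm_sub_le _ _).trans (add_le_add (hC _) (hC _))

theorem average_eq_const (ha : 0 < a) {x : ℝ} {c : ℂ} (h : ∀ y ∈ Icc (x - a) x, f y = c) :
    leftAverage a f x = c := by
  have : ∫ y in (x - a)..x, f y = ∫ _ in (x - a)..x, c :=
    intervalIntegral.integral_congr fun y hy => h y (by rwa [uIcc_of_le (by linarith)] at hy)
  rw [leftAverage, this, intervalIntegral.integral_const, sub_sub_cancel, Complex.real_smul,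
    ← mul_assoc, inv_mul_cancel₀ (by exact_mod_cast ha.ne'), one_mul]

theorem norm_average_sub_le (ha : 0 < a) (hf : ContDiff ℝ (⊤ : ℕ∞) f) {C : ℝ}
    (hC : ∀ x, ‖deriv f x‖ ≤ C) (x : ℝ) : ‖leftAverage a f x - f x‖ ≤ a * C := by
  have hi : IntervalIntegrable f volume (x - a) x := hf.continuous.intervalIntegrable _ _
  have h1 : leftAverage a f x - f x = (a⁻¹ : ℂ) * ∫ y in (x - a)..x, (f y - f x) := by
    rw [intervalIntegral.integral_sub hi (by simp), mul_sub, leftAverage,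
      intervalIntegral.integral_const, sub_sub_cancel, Complex.real_smul, ← mul_assoc,
      inv_mul_cancel₀ (by exact_mod_cast ha.ne'), one_mul]
  have h2 : ∀ y ∈ uIoc (x - a) x, ‖f y - f x‖ ≤ a * C := fun y hy => by
    rw [uIoc_of_le (by linarith)] at hy
    have h3 := Convex.norm_image_sub_le_of_norm_deriv_le (s := univ) (f := f) (C := C)
      (fun z _ => hf.differentiable (by simp) z) (fun z _ => hC z) convex_univ
      (mem_univ x) (mem_univ y)
    refine h3.trans ?_
    have hC0 : 0 ≤ C := (norm_nonneg _).trans (hC 0)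
    rw [mul_comm]
    refine mul_le_mul_of_nonneg_right ?_ hC0
    rw [Real.norm_eq_abs, abs_le]
    constructor <;> linarith [hy.1, hy.2]
  have h4 := intervalIntegral.norm_integral_le_of_norm_le_const h2
  rw [sub_sub_cancel, abs_of_pos ha] at h4
  rw [h1, norm_mul, norm_inv, Complex.norm_real, Real.norm_of_nonneg ha.le, inv_mul_le_iff₀ ha]
  linarith

/-- `leftAverage (a 0) (leftAverage (a 1) (⋯ (leftAverage (a (n - 1)) f)))`. -/
noncomputable def iterAverage (f : ℝ → ℂ) : ℕ → (ℕ → ℝ) → ℝ → ℂ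
  | 0, _ => f
  | n + 1, a => leftAverage (a 0) (iterAverage f n fun i => a (i + 1))

theorem contDiff_iterAverage (hf : ContDiff ℝ (⊤ : ℕ∞) f) (n : ℕ) (a : ℕ → ℝ) :
    ContDiff ℝ (⊤ : ℕ∞) (iterAverage f n a) := by
  induction n generalizing a with
  | zero => exact hf
  | succ n ih => exact contDiff_average (ih _)

/-- Each of the j outermost averages takes one derivative, as a difference quotient costing 2 / a_i.
The remaining averages do not increase the supremum, so no derivative falls on f. -/
theorem norm_iteratedDeriv_iterAverage_le (hf : ContDiff ℝ (⊤ : ℕ∞) f) {C : ℝ}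
    (hC : ∀ x, ‖f x‖ ≤ C) {n j : ℕ} (hj : j ≤ n) {a : ℕ → ℝ} (ha : ∀ i, 0 < a i) (x : ℝ) :
    ‖iteratedDeriv j (iterAverage f n a) x‖ ≤ (∏ i ∈ Finset.range j, 2 / a i) * C := by
  induction j generalizing n a x with
  | zero =>
    simp only [iteratedDeriv_zero, Finset.range_zero, Finset.prod_empty, one_mul]
    clear hj
    induction n generalizing a x with
    | zero => exact hC x
    | succ n ih => exact norm_average_le (ha 0) (fun y => ih (fun i => ha (i + 1)) y) x
  | succ j ih =>
    obtain ⟨n, rfl⟩ : ∃ k, n = k + 1 := ⟨n - 1, by omega⟩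
    have hs := contDiff_iterAverage hf n fun i => a (i + 1)
    have hsj : ContDiff ℝ (⊤ : ℕ∞) (iteratedDeriv j (iterAverage f n fun i => a (i + 1))) :=
      contDiff_iteratedDeriv_top hs j
    rw [iterAverage, iteratedDeriv_succ, iteratedDeriv_average hs,
      Finset.prod_range_succ', mul_comm _ (2 / a 0), mul_assoc]
    exact norm_deriv_average_le (ha 0) hsj.continuous
      (fun y => ih (by omega) (fun i => ha (i + 1)) y) x

theorem iterAverage_eq_const {n : ℕ} {a : ℕ → ℝ} (ha : ∀ i, 0 < a i) {x : ℝ} {c : ℂ}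
    (h : ∀ y ∈ Icc (x - ∑ i ∈ Finset.range n, a i) x, f y = c) : iterAverage f n a x = c := by
  induction n generalizing a x with
  | zero => exact h x (by simp)
  | succ n ih =>
    refine average_eq_const (ha 0) fun y hy => ih (fun i => ha (i + 1)) fun z hz => h z ?_
    rw [Finset.sum_range_succ']
    exact ⟨by linarith [hz.1, hy.1], hz.2.trans hy.2⟩

/-- The additional average is the innermost one and moves f^(j) by at most a_n sup |f^(j+1)|; the
outer averages contract the supremum norm. -/
theorem norm_iteratedDeriv_iterAverage_succ_sub_le (hf : ContDiff ℝ (⊤ : ℕ∞) f) (j : ℕ) {C : ℝ}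
    (hC : ∀ x, ‖iteratedDeriv (j + 1) f x‖ ≤ C) (n : ℕ) {a : ℕ → ℝ} (ha : ∀ i, 0 < a i) (x : ℝ) :
    ‖iteratedDeriv j (iterAverage f (n + 1) a) x - iteratedDeriv j (iterAverage f n a) x‖ ≤
      a n * C := by
  induction n generalizing a x with
  | zero =>
    simp only [iterAverage]
    rw [iteratedDeriv_average hf]
    exact norm_average_sub_le (ha 0) (contDiff_iteratedDeriv_top hf j)
      (fun y => by rw [← iteratedDeriv_succ]; exact hC y) x
  | succ n ih =>
    have hs : ∀ n, ContDiff ℝ (⊤ : ℕ∞) (iterAverage f n fun i => a (i + 1)) := fun n =>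
      contDiff_iterAverage hf n _
    have hc : ∀ n, Continuous (iteratedDeriv j (iterAverage f n fun i => a (i + 1))) := fun n => by
      exact (hs n).continuous_iteratedDeriv j (by exact_mod_cast le_top)
    change ‖iteratedDeriv j (leftAverage (a 0) (iterAverage f (n + 1) fun i => a (i + 1))) x -
      iteratedDeriv j (leftAverage (a 0) (iterAverage f n fun i => a (i + 1))) x‖ ≤ _
    rw [iteratedDeriv_average (hs _), iteratedDeriv_average (hs _)]
    have key := norm_average_le (a := a 0) (ha 0)
      (f := fun y => iteratedDeriv j (iterAverage f (n + 1) fun i => a (i + 1)) y -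
        iteratedDeriv j (iterAverage f n fun i => a (i + 1)) y)
      (fun y => ih (fun i => ha (i + 1)) y) x
    rw [leftAverage, intervalIntegral.integral_sub ((hc _).intervalIntegrable _ _)
      ((hc _).intervalIntegrable _ _), mul_sub] at key
    exact key

/-- The infinite iterated average of a function with bounded derivatives. -/
theorem exists_limit_iterAverage (hf : ContDiff ℝ (⊤ : ℕ∞) f)
    (hfb : ∀ j, ∃ C, ∀ x, ‖iteratedDeriv j f x‖ ≤ C) {C : ℝ} (hC : ∀ x, ‖f x‖ ≤ C)
    {a : ℕ → ℝ} (ha : ∀ i, 0 < a i) (hs : Summable a) :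
    ∃ θ : ℝ → ℂ, ContDiff ℝ (⊤ : ℕ∞) θ ∧
      (∀ j x, ‖iteratedDeriv j θ x‖ ≤ (∏ i ∈ Finset.range j, 2 / a i) * C) ∧
      ∀ x c, (∀ y ∈ Icc (x - ∑' i, a i) x, f y = c) → θ x = c := by
  choose B hB using hfb
  set F : ℕ → ℝ → ℂ := fun n => iterAverage f n a with hF
  have hFs : ∀ n, ContDiff ℝ (⊤ : ℕ∞) (F n) := fun n => contDiff_iterAverage hf n a
  have hle : ∀ k : ℕ, ((k : ℕ∞) : WithTop ℕ∞) ≤ ((⊤ : ℕ∞) : WithTop ℕ∞) := fun k => by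
    exact_mod_cast le_top
  -- The limit is the telescoping series f + Σ D n, whose derivatives of each order converge
  -- uniformly because a is summable.
  set D : ℕ → ℝ → ℂ := fun n => F (n + 1) - F n with hD
  have hDs : ∀ n, ContDiff ℝ (⊤ : ℕ∞) (D n) := fun n => (hFs (n + 1)).sub (hFs n)
  have hDit : ∀ k n x, iteratedFDeriv ℝ k (D n) x =
      iteratedFDeriv ℝ k (F (n + 1)) x - iteratedFDeriv ℝ k (F n) x := fun k n x =>
    iteratedFDeriv_sub_apply ((hFs (n + 1)).of_le (hle k)).contDiffAt
      ((hFs n).of_le (hle k)).contDiffAt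
  have hDb : ∀ (k : ℕ) (n : ℕ) (x : ℝ), (k : ℕ∞) ≤ ⊤ →
      ‖iteratedFDeriv ℝ k (D n) x‖ ≤ a n * B (k + 1) := fun k n x _ => by
    rw [norm_iteratedFDeriv_eq_norm_iteratedDeriv, hD]
    simp only
    rw [iteratedDeriv_sub ((hFs (n + 1)).of_le (hle k)).contDiffAt
      ((hFs n).of_le (hle k)).contDiffAt]
    exact norm_iteratedDeriv_iterAverage_succ_sub_le hf k (hB _) n ha x
  have hsum : ∀ k : ℕ, (k : ℕ∞) ≤ ⊤ → Summable fun n => a n * B (k + 1) :=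
    fun k _ => hs.mul_right _
  have hT : ContDiff ℝ (⊤ : ℕ∞) fun x => ∑' n, D n x := contDiff_tsum hDs hsum hDb
  have hlim : ∀ k x, Filter.Tendsto (fun n => iteratedFDeriv ℝ k (F n) x) Filter.atTop
      (nhds (iteratedFDeriv ℝ k (fun x => f x + ∑' n, D n x) x)) := fun k x => by
    have h1 : iteratedFDeriv ℝ k (fun x => f x + ∑' n, D n x) x =
        iteratedFDeriv ℝ k f x + ∑' n, iteratedFDeriv ℝ k (D n) x := by
      have := iteratedFDeriv_add_apply (x := x) (hf.of_le (hle k)).contDiffAt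
        (hT.of_le (hle k)).contDiffAt
      rw [iteratedFDeriv_tsum hDs hsum hDb (k := k) le_top] at this
      exact this
    have h2 : ∀ n, iteratedFDeriv ℝ k f x + ∑ i ∈ Finset.range n, iteratedFDeriv ℝ k (D i) x =
        iteratedFDeriv ℝ k (F n) x := fun n => by
      simp only [hDit]
      rw [Finset.sum_range_sub (fun n => iteratedFDeriv ℝ k (F n) x)]
      exact add_sub_cancel _ _
    rw [h1]
    simp only [← h2]
    refine Filter.Tendsto.const_add _ ?_
    refine (Summable.of_norm_bounded (hsum k le_top) fun n => ?_).hasSum.tendsto_sum_nat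
    exact hDb k n x le_top
  refine ⟨fun x => f x + ∑' n, D n x, hf.add hT, fun j x => ?_, fun x c hc => ?_⟩
  · rw [← norm_iteratedFDeriv_eq_norm_iteratedDeriv]
    refine le_of_tendsto (hlim j x).norm ?_
    filter_upwards [Filter.eventually_ge_atTop j] with n hn
    rw [norm_iteratedFDeriv_eq_norm_iteratedDeriv]
    exact norm_iteratedDeriv_iterAverage_le hf hC hn ha x
  · have h0 : Filter.Tendsto (fun n => F n x) Filter.atTop (nhds (f x + ∑' n, D n x)) := by
      have h1 := (hlim 0 x)
      have h2 := ((ContinuousMultilinearMap.apply ℝ (fun _ : Fin 0 => ℝ) ℂ 0).continuous.tendsto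
        _).comp h1
      simpa [Function.comp_def] using h2
    refine tendsto_nhds_unique h0 (tendsto_const_nhds.congr fun n => ?_)
    refine (iterAverage_eq_const ha fun y hy => hc y ⟨?_, hy.2⟩).symm
    have := hs.sum_le_tsum (Finset.range n) fun i _ => (ha i).le
    linarith [hy.1]

end Averaging

/-! ### Leibniz rule and geometric losses in the derivative estimates. -/

namespace NQWeight

variable (ω : NQWeight)

theorem exists_factor_le_inv_pow_mul {L : ℕ} (hL : 1 ≤ L) :
    ∃ Q : ℕ+, ∀ (m : ℕ+) (k : ℕ), ω.factor m k ≤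
      ((L : ℝ≥0∞) ^ k)⁻¹ * (ENNReal.ofReal (Real.exp (m * Q)) * ω.factor ((m * Q : ℕ+) : ℝ) k) := by
  obtain ⟨Q, hQ⟩ := ω.exists_pow_mul_factor_le (L := L) (by exact_mod_cast hL)
  refine ⟨Q, fun m k => ?_⟩
  have h0 : (L : ℝ≥0∞) ^ k ≠ 0 := pow_ne_zero _ (by exact_mod_cast (by omega : L ≠ 0))
  have h1 : (L : ℝ≥0∞) ^ k ≠ ∞ := ENNReal.pow_ne_top (ENNReal.natCast_ne_top L)
  have h := hQ m k
  rw [ENNReal.ofReal_pow (Nat.cast_nonneg _), ENNReal.ofReal_natCast] at h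
  calc ω.factor m k = ((L : ℝ≥0∞) ^ k)⁻¹ * ((L : ℝ≥0∞) ^ k * ω.factor m k) := by
        rw [← mul_assoc, ENNReal.inv_mul_cancel h0 h1, one_mul]
    _ ≤ _ := by gcongr

/-- Passing from partial to full derivatives costs N^k, absorbed by enlarging m. The base N + 1 is
at least 1 also when N = 0. -/
theorem exists_enorm_iteratedFDeriv_mul_factor_le (N : ℕ) :
    ∃ Q : ℕ+, ∀ {f : EuclideanSpace ℝ (Fin N) → ℂ}, ContDiff ℝ (⊤ : ℕ∞) f →
      ∀ (m : ℕ+) (x : EuclideanSpace ℝ (Fin N)) (P : ℝ≥0∞),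
      (∀ α : Fin N → ℕ, ‖partialDeriv α f x‖ₑ * ω.factor ((m * Q : ℕ+) : ℝ) (∑ i, α i) ≤ P) →
      ∀ k : ℕ, ‖iteratedFDeriv ℝ k f x‖ₑ * ω.factor m k ≤
        ENNReal.ofReal (Real.exp (m * Q)) * P := by
  obtain ⟨Q, hQ⟩ := ω.exists_factor_le_inv_pow_mul (L := N + 1) (by omega)
  refine ⟨Q, fun {f} hf m x P hP k => ?_⟩
  have h1 := enorm_iteratedFDeriv_mul_le hf (k := k) (x := x)
    (c := ω.factor ((m * Q : ℕ+) : ℝ) k) (P := P) fun α hα => by simpa [hα] using hP α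
  have h2 : (N : ℝ≥0∞) ^ k ≤ ((N + 1 : ℕ) : ℝ≥0∞) ^ k := by
    gcongr
    omega
  set c := ENNReal.ofReal (Real.exp (m * Q))
  calc _ ≤ ‖iteratedFDeriv ℝ k f x‖ₑ *
        ((((N + 1 : ℕ) : ℝ≥0∞) ^ k)⁻¹ * (c * ω.factor ((m * Q : ℕ+) : ℝ) k)) := by
        gcongr
        exact hQ m k
    _ = (((N + 1 : ℕ) : ℝ≥0∞) ^ k)⁻¹ * (c *
        (‖iteratedFDeriv ℝ k f x‖ₑ * ω.factor ((m * Q : ℕ+) : ℝ) k)) := by ring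
    _ ≤ (((N + 1 : ℕ) : ℝ≥0∞) ^ k)⁻¹ * (c * (((N + 1 : ℕ) : ℝ≥0∞) ^ k * P)) := by
        exact mul_le_mul_right (mul_le_mul_right (h1.trans (mul_le_mul_left h2 P)) _) _
    _ = ((((N + 1 : ℕ) : ℝ≥0∞) ^ k)⁻¹ * ((N + 1 : ℕ) : ℝ≥0∞) ^ k) * (c * P) := by ring
    _ ≤ _ := by
        refine (mul_le_mul_left (ENNReal.inv_mul_le_one _) _).trans ?_
        rw [one_mul]

variable {E : Type*} [NormedAddCommGroup E] [NormedSpace ℝ E]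

/-- By `factor_add_le` the factor splits along each Leibniz term, and the binomial sum 2^k is
absorbed by enlarging m. -/
theorem exists_enorm_iteratedFDeriv_mul_mul_factor_le :
    ∃ Q : ℕ+, ∀ {f g : E → ℂ}, ContDiff ℝ (⊤ : ℕ∞) f → ContDiff ℝ (⊤ : ℕ∞) g →
      ∀ (m : ℕ+) (x : E) (P P' : ℝ≥0∞),
      (∀ k, ‖iteratedFDeriv ℝ k f x‖ₑ * ω.factor ((m * Q : ℕ+) : ℝ) k ≤ P) →
      (∀ k, ‖iteratedFDeriv ℝ k g x‖ₑ * ω.factor ((m * Q : ℕ+) : ℝ) k ≤ P') →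
      ∀ k : ℕ, ‖iteratedFDeriv ℝ k (fun y => f y * g y) x‖ₑ * ω.factor m k ≤
        ENNReal.ofReal (Real.exp (m * Q)) * (P * P') := by
  obtain ⟨Q, hQ⟩ := ω.exists_factor_le_inv_pow_mul (L := 2) (by omega)
  refine ⟨Q, fun {f g} hf hg m x P P' hP hP' k => ?_⟩
  set c := ENNReal.ofReal (Real.exp (m * Q))
  have h1 : ‖iteratedFDeriv ℝ k (fun y => f y * g y) x‖ₑ ≤
      ∑ i ∈ Finset.range (k + 1), (k.choose i : ℝ≥0∞) * ‖iteratedFDeriv ℝ i f x‖ₑ *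
        ‖iteratedFDeriv ℝ (k - i) g x‖ₑ := by
    have := ENNReal.ofReal_le_ofReal (norm_iteratedFDeriv_mul_le hf hg x (n := k)
      (by exact_mod_cast le_top))
    rw [ENNReal.ofReal_sum_of_nonneg fun i _ => by positivity] at this
    rw [← ofReal_norm]
    refine this.trans (Finset.sum_le_sum fun i _ => ?_)
    rw [ENNReal.ofReal_mul (by positivity), ENNReal.ofReal_mul (by positivity), ofReal_norm,
      ofReal_norm, ENNReal.ofReal_natCast]
  have h2 : ∀ i ∈ Finset.range (k + 1), (k.choose i : ℝ≥0∞) * ‖iteratedFDeriv ℝ i f x‖ₑ *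
      ‖iteratedFDeriv ℝ (k - i) g x‖ₑ * ω.factor ((m * Q : ℕ+) : ℝ) k ≤
      (k.choose i : ℝ≥0∞) * (P * P') := fun i hi => by
    have hik : i + (k - i) = k := by
      have := Finset.mem_range.1 hi
      omega
    have h3 := ω.factor_add_le (m * Q) i (k - i)
    rw [hik] at h3
    calc _ ≤ (k.choose i : ℝ≥0∞) * ‖iteratedFDeriv ℝ i f x‖ₑ *
          ‖iteratedFDeriv ℝ (k - i) g x‖ₑ * (ω.factor ((m * Q : ℕ+) : ℝ) i *
            ω.factor ((m * Q : ℕ+) : ℝ) (k - i)) := by gcongr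
      _ = (k.choose i : ℝ≥0∞) * ((‖iteratedFDeriv ℝ i f x‖ₑ * ω.factor ((m * Q : ℕ+) : ℝ) i) *
          (‖iteratedFDeriv ℝ (k - i) g x‖ₑ * ω.factor ((m * Q : ℕ+) : ℝ) (k - i))) := by ring
      _ ≤ _ := by
          gcongr
          · exact hP i
          · exact hP' (k - i)
  have h4 : ∑ i ∈ Finset.range (k + 1), (k.choose i : ℝ≥0∞) * (P * P') =
      ((2 : ℕ) : ℝ≥0∞) ^ k * (P * P') := by
    rw [← Finset.sum_mul]
    congr 1
    exact_mod_cast Nat.sum_range_choose k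
  calc _ ≤ (∑ i ∈ Finset.range (k + 1), (k.choose i : ℝ≥0∞) * ‖iteratedFDeriv ℝ i f x‖ₑ *
        ‖iteratedFDeriv ℝ (k - i) g x‖ₑ) *
        ((((2 : ℕ) : ℝ≥0∞) ^ k)⁻¹ * (c * ω.factor ((m * Q : ℕ+) : ℝ) k)) := by
        gcongr
        exact hQ m k
    _ = (((2 : ℕ) : ℝ≥0∞) ^ k)⁻¹ * (c * ((∑ i ∈ Finset.range (k + 1), (k.choose i : ℝ≥0∞) *
        ‖iteratedFDeriv ℝ i f x‖ₑ * ‖iteratedFDeriv ℝ (k - i) g x‖ₑ) *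
          ω.factor ((m * Q : ℕ+) : ℝ) k)) := by ring
    _ ≤ (((2 : ℕ) : ℝ≥0∞) ^ k)⁻¹ * (c * (((2 : ℕ) : ℝ≥0∞) ^ k * (P * P'))) := by
        rw [Finset.sum_mul, ← h4]
        exact mul_le_mul_right (mul_le_mul_right (Finset.sum_le_sum h2) _) _
    _ = ((((2 : ℕ) : ℝ≥0∞) ^ k)⁻¹ * ((2 : ℕ) : ℝ≥0∞) ^ k) * (c * (P * P')) := by ring
    _ ≤ _ := by
        refine (mul_le_mul_left (ENNReal.inv_mul_le_one _) _).trans ?_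
        rw [one_mul]

end NQWeight

/-! ### Compactly supported cutoff functions. -/

section UltraBounded

variable (ω : NQWeight) {E F : Type*} [NormedAddCommGroup E] [NormedSpace ℝ E]
  [NormedAddCommGroup F] [NormedSpace ℝ F]

/-- Smooth functions with globally bounded derivatives `|f^(k)| ≤ C_m exp (m φ*(k / m))`. -/
structure UltraBounded (f : E → ℂ) : Prop where
  contDiff : ContDiff ℝ (⊤ : ℕ∞) f
  bound : ∀ m : ℕ+, ∃ C : ℝ≥0∞, C ≠ ∞ ∧
    ∀ k x, ‖iteratedFDeriv ℝ k f x‖ₑ * ω.factor m k ≤ C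

variable {ω}

theorem ultraBounded_const (c : ℂ) : UltraBounded ω fun _ : E => c := by
  refine ⟨contDiff_const, fun m => ⟨‖c‖ₑ * ω.factor m 0,
    ENNReal.mul_ne_top enorm_ne_top (ω.factor_ne_top m 0), fun k x => ?_⟩⟩
  rcases k with _ | k
  · rw [← ofReal_norm, norm_iteratedFDeriv_zero, ofReal_norm]
  · rw [iteratedFDeriv_succ_const, Pi.zero_apply, ← ofReal_norm, norm_zero, ENNReal.ofReal_zero,
      zero_mul]
    exact zero_le

theorem UltraBounded.mul {f g : E → ℂ} (hf : UltraBounded ω f) (hg : UltraBounded ω g) :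
    UltraBounded ω fun x => f x * g x := by
  obtain ⟨Q, hQ⟩ := ω.exists_enorm_iteratedFDeriv_mul_mul_factor_le (E := E)
  refine ⟨hf.contDiff.mul hg.contDiff, fun m => ?_⟩
  obtain ⟨P, hPt, hP⟩ := hf.bound (m * Q)
  obtain ⟨P', hPt', hP'⟩ := hg.bound (m * Q)
  exact ⟨_, ENNReal.mul_ne_top ENNReal.ofReal_ne_top (ENNReal.mul_ne_top hPt hPt'),
    fun k x => hQ hf.contDiff hg.contDiff m x P P' (fun k => hP k x) (fun k => hP' k x) k⟩

theorem UltraBounded.prod {ι : Type*} (s : Finset ι) {f : ι → E → ℂ}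
    (hf : ∀ i, UltraBounded ω (f i)) : UltraBounded ω fun x => ∏ i ∈ s, f i x := by
  classical
  induction s using Finset.induction_on with
  | empty => simpa using ultraBounded_const 1
  | insert i s hi ih =>
    simp only [Finset.prod_insert hi]
    exact (hf i).mul ih

theorem UltraBounded.comp_clm {f : E → ℂ} (hf : UltraBounded ω f) {T : F →L[ℝ] E} (hT : ‖T‖ ≤ 1) :
    UltraBounded ω fun x => f (T x) := by
  refine ⟨hf.contDiff.comp T.contDiff, fun m => ?_⟩
  obtain ⟨C, hCt, hC⟩ := hf.bound m
  refine ⟨C, hCt, fun k x => le_trans (mul_le_mul_left ?_ _) (hC k (T x))⟩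
  change ‖iteratedFDeriv ℝ k (f ∘ T) x‖ₑ ≤ _
  rw [← ofReal_norm, ← ofReal_norm, T.iteratedFDeriv_comp_right hf.contDiff x (i := k)
    (by exact_mod_cast le_top)]
  refine ENNReal.ofReal_le_ofReal
    ((ContinuousMultilinearMap.norm_compContinuousLinearMap_le _ _).trans ?_)
  refine mul_le_of_le_one_right (norm_nonneg _) ?_
  rw [Finset.prod_const]
  exact pow_le_one₀ (norm_nonneg _) hT

variable (ω)

/-- One-dimensional cutoff functions. -/
theorem exists_ultraBounded_real (R : ℝ) : ∃ θ : ℝ → ℂ, UltraBounded ω θ ∧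
    (∀ x, |x| ≤ R → θ x = 1) ∧ ∃ R', 0 ≤ R' ∧ ∀ x, R' < |x| → θ x = 0 := by
  obtain ⟨κ, hκm, hκs, hκ⟩ := ω.exists_scales
  set S : ℝ := ∑' i, ((2 : ℝ) ^ κ i)⁻¹ with hS
  have hS0 : 0 ≤ S := tsum_nonneg fun i => by positivity
  -- The iterated average at x sees only [x - S, x], so the plateau of b must exceed [-R, R] by S.
  let b : ContDiffBump (0 : ℝ) := ⟨|R| + S + 1, |R| + S + 2, by positivity, by linarith⟩
  set f : ℝ → ℂ := fun x => ((b x : ℝ) : ℂ) with hf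
  have hfs : ContDiff ℝ (⊤ : ℕ∞) f := Complex.ofRealCLM.contDiff.comp b.contDiff
  have hfc : HasCompactSupport f := b.hasCompactSupport.comp_left Complex.ofReal_zero
  have hfb : ∀ j, ∃ C, ∀ x, ‖iteratedDeriv j f x‖ ≤ C := fun j => by
    obtain ⟨C, hC⟩ := (hfc.iteratedFDeriv (𝕜 := ℝ) j).exists_bound_of_continuous
      (hfs.continuous_iteratedFDeriv (m := j) (by exact_mod_cast le_top))
    exact ⟨C, fun x => by rw [← norm_iteratedFDeriv_eq_norm_iteratedDeriv]; exact hC x⟩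
  have hf1 : ∀ x, ‖f x‖ ≤ 1 := fun x => by
    rw [hf, Complex.norm_real, Real.norm_of_nonneg b.nonneg]
    exact b.le_one
  obtain ⟨θ, hθs, hθb, hθc⟩ := exists_limit_iterAverage hfs hfb hf1
    (a := fun i => ((2 : ℝ) ^ κ i)⁻¹) (fun i => by positivity) hκs
  refine ⟨θ, ⟨hθs, fun m => ?_⟩, fun x hx => hθc x 1 fun y hy => ?_,
    |R| + 2 * S + 2, by positivity, fun x hx => hθc x 0 fun y hy => ?_⟩
  · obtain ⟨C, hC⟩ := hκ m
    refine ⟨ENNReal.ofReal (Real.exp C), ENNReal.ofReal_ne_top, fun j x => ?_⟩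
    have hpos : (0 : ℝ) < 2 ^ (κ j + 2) := by positivity
    have ht : 0 ≤ Real.log (2 ^ (κ j + 2)) := Real.log_nonneg (one_le_pow₀ one_le_two)
    have h1 : ‖iteratedFDeriv ℝ j θ x‖ ≤ (2 ^ (κ j + 1)) ^ j := by
      rw [norm_iteratedFDeriv_eq_norm_iteratedDeriv]
      refine (hθb j x).trans ?_
      rw [mul_one]
      refine (Finset.prod_le_prod (g := fun _ => (2 : ℝ) ^ (κ j + 1)) (fun i _ => by positivity)
        fun i hi => ?_).trans (by simp)
      rw [div_inv_eq_mul, ← pow_succ']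
      exact pow_le_pow_right₀ one_le_two
        (Nat.succ_le_succ (hκm (Finset.mem_range.1 hi).le))
    rw [← ofReal_norm]
    -- Testing the infimum at e^t = 2^(κ_j + 2), one power of 2 above the derivative bound, leaves
    -- exp(m ω(2^(κ_j + 2)) - j log 2), which is at most e^C by the choice of scales.
    refine (mul_le_mul' (ENNReal.ofReal_le_ofReal h1) (ω.factor_le m j ht)).trans ?_
    rw [← ENNReal.ofReal_mul (by positivity), Real.exp_log hpos]
    refine ENNReal.ofReal_le_ofReal ?_
    have h2 : ((2 : ℝ) ^ (κ j + 1)) ^ j = Real.exp (j * ((κ j + 1) * Real.log 2)) := by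
      rw [Real.exp_nat_mul]
      congr 1
      have : ((κ j : ℝ) + 1) = ((κ j + 1 : ℕ) : ℝ) := by push_cast; rfl
      rw [this, Real.exp_nat_mul, Real.exp_log two_pos]
    rw [h2, ← Real.exp_add, Real.exp_le_exp, Real.log_pow]
    have := hC j
    push_cast
    linarith
  · have hRabs := le_abs_self R
    have hx' := abs_le.1 hx
    have : b y = 1 := b.one_of_mem_closedBall (by
      rw [mem_closedBall_zero_iff, Real.norm_eq_abs, abs_le]
      change -(|R| + S + 1) ≤ y ∧ y ≤ |R| + S + 1
      constructor <;> linarith [hy.1, hy.2])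
    simp [hf, this]
  · have : b y = 0 := b.zero_of_le_dist (by
      change |R| + S + 2 ≤ _
      rw [dist_zero_right, Real.norm_eq_abs]
      rcases lt_abs.1 hx with h | h
      · exact le_trans (by linarith [hy.1]) (le_abs_self y)
      · exact le_trans (by linarith [hy.2]) (neg_le_abs y))
    simp [hf, this]

/-- Nonquasianalytic cutoff functions. -/
theorem exists_ultraBounded_cutoff (N : ℕ) (R : ℝ) : ∃ χ : EuclideanSpace ℝ (Fin N) → ℂ,
    UltraBounded ω χ ∧ (∀ x, ‖x‖ ≤ R → χ x = 1) ∧ HasCompactSupport χ := by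
  obtain ⟨θ, hθ, hθ1, R', hR'0, hR'⟩ := exists_ultraBounded_real ω R
  refine ⟨fun x => ∏ i, θ (x i), UltraBounded.prod _ fun i => ?_, fun x hx => ?_, ?_⟩
  · exact hθ.comp_clm (T := EuclideanSpace.proj (𝕜 := ℝ) i)
      (ContinuousLinearMap.opNorm_le_bound _ zero_le_one fun x => by
        simpa using PiLp.norm_apply_le x i)
  · refine Finset.prod_eq_one fun i _ => hθ1 _ ?_
    exact (PiLp.norm_apply_le x i).trans hx
  · refine HasCompactSupport.of_support_subset_isCompact
      (isCompact_closedBall 0 (N * R')) fun x hx => ?_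
    have hxi : ∀ i, |x i| ≤ R' := fun i => by
      by_contra h
      exact (Finset.prod_ne_zero_iff.1 (Function.mem_support.1 hx)) i (Finset.mem_univ i)
        (hR' _ (not_le.1 h))
    rw [mem_closedBall_zero_iff]
    have hx' : ∑ i, x i • EuclideanSpace.single i (1 : ℝ) = x := by
      simpa using (EuclideanSpace.basisFun (Fin N) ℝ).sum_repr x
    rw [← hx']
    refine (norm_sum_le_of_le (n := fun _ => R') _ fun i _ => ?_).trans (by simp)
    rw [norm_smul]
    simpa using hxi i

end UltraBounded

/-! ### Criteria for membership in O_{M,ω}. -/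

section Membership

variable {ω : NQWeight} {N : ℕ}

theorem one_le_exp_mul_enorm_gauss {R : ℝ} {x : EuclideanSpace ℝ (Fin N)} (hx : ‖x‖ ≤ R) :
    1 ≤ ENNReal.ofReal (Real.exp (R ^ 2 / 2)) * ‖(gauss x : ℂ)‖ₑ := by
  rw [gauss_eq_ofReal, ← ofReal_norm, Complex.norm_real, Real.norm_of_nonneg (Real.exp_pos _).le,
    ← ENNReal.ofReal_mul (Real.exp_pos _).le, ← Real.exp_add, ENNReal.one_le_ofReal,
    Real.one_le_exp_iff]
  have := pow_le_pow_left₀ (norm_nonneg x) hx 2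
  linarith

theorem enorm_partialDeriv_mul_factor_le_qSup_gauss {R : ℝ} {x : EuclideanSpace ℝ (Fin N)}
    (hx : ‖x‖ ≤ R) (m : ℕ+) (f : EuclideanSpace ℝ (Fin N) → ℂ) (α : Fin N → ℕ) :
    ‖partialDeriv α f x‖ₑ * ω.factor m (∑ i, α i) ≤
      ENNReal.ofReal (Real.exp (R ^ 2 / 2)) * qSup ω m gauss f := by
  calc _ ≤ (ENNReal.ofReal (Real.exp (R ^ 2 / 2)) * ‖(gauss x : ℂ)‖ₑ) *
        (‖partialDeriv α f x‖ₑ * ω.factor m (∑ i, α i)) :=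
        le_mul_of_one_le_left zero_le (one_le_exp_mul_enorm_gauss hx)
    _ = ENNReal.ofReal (Real.exp (R ^ 2 / 2)) *
        (‖(gauss x : ℂ)‖ₑ * ‖partialDeriv α f x‖ₑ * ω.factor m (∑ i, α i)) := by ring
    _ ≤ _ := by
        gcongr
        exact le_iSup₂_of_le α x le_rfl

theorem pSup_le_qSup_gauss {R : ℝ} {K : Set (EuclideanSpace ℝ (Fin N))}
    (hK : ∀ x ∈ K, ‖x‖ ≤ R) (m : ℕ+) (f : EuclideanSpace ℝ (Fin N) → ℂ) :
    pSup ω K m f ≤ ENNReal.ofReal (Real.exp (R ^ 2 / 2)) * qSup ω m gauss f :=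
  iSup₂_le fun x hx => iSup_le fun α => enorm_partialDeriv_mul_factor_le_qSup_gauss (hK x hx) m f α

/-- Choose m so that the factor of order k is nonzero and can be divided out of the Gaussian
seminorm. -/
theorem exists_norm_iteratedFDeriv_le (ω : NQWeight) (N : ℕ) (k : ℕ) (R : ℝ) :
    ∃ (m : ℕ+) (C : ℝ), 0 ≤ C ∧ ∀ f ∈ OMSubmodule ω N, ∀ x, ‖x‖ ≤ R →
      ‖iteratedFDeriv ℝ k f x‖ ≤ C * (qSup ω m gauss f).toReal := by
  obtain ⟨m, hm⟩ := ω.exists_factor_ne_zero k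
  set c := (N : ℝ≥0∞) ^ k * ENNReal.ofReal (Real.exp (R ^ 2 / 2)) / ω.factor m k with hc
  have hct : c ≠ ∞ := ENNReal.div_ne_top (ENNReal.mul_ne_top
    (ENNReal.pow_ne_top (ENNReal.natCast_ne_top N)) ENNReal.ofReal_ne_top) hm
  refine ⟨m, c.toReal, ENNReal.toReal_nonneg, fun f hf x hx => ?_⟩
  have hq := (qSup_lt_top ω m memS_gauss hf).ne
  have h1 := enorm_iteratedFDeriv_mul_le hf.1 (k := k) (x := x) (c := ω.factor m k)
    (P := ENNReal.ofReal (Real.exp (R ^ 2 / 2)) * qSup ω m gauss f) fun α hα => by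
      simpa [hα] using enorm_partialDeriv_mul_factor_le_qSup_gauss (ω := ω) hx m f α
  have h2 : ‖iteratedFDeriv ℝ k f x‖ₑ ≤ c * qSup ω m gauss f := by
    rw [hc, ENNReal.mul_comm_div, ← mul_div_assoc, ENNReal.le_div_iff_mul_le (Or.inl hm)
      (Or.inl (ω.factor_ne_top m k))]
    exact h1.trans (le_of_eq (by ring))
  rw [← ENNReal.toReal_mul, ← toReal_enorm]
  exact ENNReal.toReal_mono (ENNReal.mul_ne_top hct hq) h2

/-- Boundedness against all of `S_ω` implies a bound by some `exp (n ω)`. -/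
theorem mem_OMSubmodule_of_qSup_lt_top {f : EuclideanSpace ℝ (Fin N) → ℂ}
    (hf : ContDiff ℝ (⊤ : ℕ∞) f) (hq : ∀ (m : ℕ+) g, MemS ω g → qSup ω m g f < ∞) :
    f ∈ OMSubmodule ω N := by
  refine ⟨hf, fun m => ?_⟩
  by_contra hcon
  simp only [not_exists, not_lt, top_le_iff] at hcon
  have hpt : ∀ n : ℕ, ∃ x : EuclideanSpace ℝ (Fin N), (n : ℝ) ≤ ω ‖x‖ ∧ ∃ α : Fin N → ℕ,
      (n : ℝ≥0∞) ≤ ENNReal.ofReal (Real.exp (-(n * ω ‖x‖))) * ‖partialDeriv α f x‖ₑ *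
        ω.factor m (∑ i, α i) := by
    intro n
    obtain ⟨R, hR⟩ := Filter.eventually_atTop.1 (ω.tendsto_atTop.eventually_ge_atTop (n : ℝ))
    -- The second entry bounds the weighted derivatives on the ball of radius R. A point exceeding
    -- it lies outside, where ω ≥ n.
    have hC : max (n : ℝ≥0∞) (ENNReal.ofReal (Real.exp (R ^ 2 / 2)) * qSup ω m gauss f) < ∞ :=
      max_lt (ENNReal.natCast_lt_top n)
        (ENNReal.mul_lt_top ENNReal.ofReal_lt_top (hq m gauss memS_gauss))
    rw [← hcon n.succPNat, rSup] at hC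
    obtain ⟨α, hC⟩ := lt_iSup_iff.1 hC
    obtain ⟨x, hC⟩ := lt_iSup_iff.1 hC
    have h0 := ω.nonneg ‖x‖ (norm_nonneg x)
    rw [max_lt_iff] at hC
    refine ⟨x, hR _ ?_, α, ?_⟩
    · by_contra hlt
      refine absurd hC.2 (not_lt.2 ((?_ : _ ≤ _).trans
        (enorm_partialDeriv_mul_factor_le_qSup_gauss (not_le.1 hlt).le m f α)))
      refine mul_le_mul_right (mul_le_of_le_one_left zero_le ?_) _
      rw [ENNReal.ofReal_le_one, Real.exp_le_one_iff]
      have : 0 ≤ ((n.succPNat : ℕ) : ℝ) * ω ‖x‖ := by positivity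
      linarith
    · refine hC.1.le.trans (le_trans (le_of_eq (mul_left_comm _ _ _)) ?_)
      rw [mul_assoc]
      gcongr
      simp
  choose x hx α hα using hpt
  obtain ⟨g, hg, hgx⟩ := exists_memS_ge hx
  obtain ⟨n, hn⟩ := ENNReal.exists_nat_gt (hq m g hg).ne
  refine absurd hn (not_lt.2 ((hα n).trans ?_))
  have h1 : ENNReal.ofReal (Real.exp (-(n * ω ‖x n‖))) ≤ ‖g (x n)‖ₑ := by
    rw [← ofReal_norm]
    exact ENNReal.ofReal_le_ofReal (hgx n)
  refine le_iSup₂_of_le (α n) (x n) ?_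
  gcongr

/-- On the compact support of χ the Leibniz estimate applies with the seminorm of f there; elsewhere
all derivatives vanish. The bound is global, so n = 1 serves for every m. -/
theorem UltraBounded.mul_mem_OMSubmodule {χ f : EuclideanSpace ℝ (Fin N) → ℂ}
    (hχ : UltraBounded ω χ) (hχc : HasCompactSupport χ) (hf : f ∈ ESubmodule ω N) :
    (fun x => χ x * f x) ∈ OMSubmodule ω N := by
  obtain ⟨Q, hQ⟩ := ω.exists_enorm_iteratedFDeriv_mul_mul_factor_le
    (E := EuclideanSpace ℝ (Fin N))
  obtain ⟨Q', hQ'⟩ := ω.exists_enorm_iteratedFDeriv_mul_factor_le N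
  refine ⟨hχ.contDiff.mul hf.1, fun m => ⟨1, ?_⟩⟩
  obtain ⟨C, hCt, hC⟩ := hχ.bound (m * Q)
  have hP := hf.2 (tsupport χ) hχc (m * Q * Q')
  set P := pSup ω (tsupport χ) (m * Q * Q') f
  set B := ENNReal.ofReal (Real.exp (m * Q)) *
    (C * (ENNReal.ofReal (Real.exp ((m * Q : ℕ+) * Q')) * P)) with hB
  have hBt : B < ∞ := by
    refine ENNReal.mul_lt_top ENNReal.ofReal_lt_top (ENNReal.mul_lt_top hCt.lt_top
      (ENNReal.mul_lt_top ENNReal.ofReal_lt_top hP))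
  refine lt_of_le_of_lt (iSup₂_le fun α x => ?_) hBt
  have h1 : ENNReal.ofReal (Real.exp (-(((1 : ℕ+) : ℕ) * ω ‖x‖))) ≤ 1 := by
    rw [ENNReal.ofReal_le_one, Real.exp_le_one_iff]
    have := ω.nonneg ‖x‖ (norm_nonneg x)
    simpa using this
  have h2 : ‖partialDeriv α (fun x => χ x * f x) x‖ₑ * ω.factor m (∑ i, α i) ≤ B := by
    by_cases hx : x ∈ tsupport χ
    · refine (mul_le_mul_left (enorm_partialDeriv_le α x) _).trans ?_
      refine hQ hχ.contDiff hf.1 m x C _ (fun k => hC k x) (hQ' hf.1 (m * Q) x P fun β => ?_) _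
      exact le_iSup₂_of_le x hx (le_iSup
        (fun α => ‖partialDeriv α f x‖ₑ * ω.factor ((m * Q * Q' : ℕ+) : ℝ) (∑ i, α i)) β)
    · have h0 : iteratedFDeriv ℝ (∑ i, α i) (fun x => χ x * f x) x = 0 := by
        by_contra hne
        exact hx (tsupport_mul_subset_left (support_iteratedFDeriv_subset _
          (Function.mem_support.2 hne)))
      have h3 : partialDeriv α (fun x => χ x * f x) x = 0 := by
        rw [partialDeriv, h0]
        rfl
      rw [h3, enorm_zero, zero_mul]
      exact zero_le
  refine le_trans ?_ h2
  gcongr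
  exact mul_le_of_le_one_left zero_le h1

end Membership

/-! ### Continuity, density, separation and completeness. -/

section Topology

variable (ω : NQWeight) (N : ℕ)

instance : IsUniformAddGroup (OMSpace ω N) := isUniformAddGroup_iInf fun i =>
  @SeminormedAddCommGroup.to_isUniformAddGroup _ (OMSeminorm ω N i).toSeminormedAddCommGroup

theorem OMSpace.withSeminorms : WithSeminorms (OMSeminorm ω N) := by
  have : Nonempty (ℕ+ × {g : EuclideanSpace ℝ (Fin N) → ℂ // MemS ω g}) :=
    ⟨⟨1, ⟨gauss, memS_gauss⟩⟩⟩
  exact (SeminormFamily.withSeminorms_iff_uniformSpace_eq_iInf _).2 rfl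

theorem continuous_inclOME : Continuous (inclOME ω N) := by
  refine (OMSpace.withSeminorms ω N).continuous_of_isBounded (ESpace.withSeminorms ω N)
    (inclOME ω N) fun i => ?_
  obtain ⟨⟨K, hK⟩, m⟩ := i
  obtain ⟨R, hR⟩ := hK.isBounded.exists_norm_le
  refine ⟨{(m, ⟨gauss, memS_gauss⟩)}, ⟨Real.exp (R ^ 2 / 2), (Real.exp_pos _).le⟩, fun f => ?_⟩
  rw [Finset.sup_singleton]
  change (pSup ω K m f.1).toReal ≤ Real.exp (R ^ 2 / 2) * (qSup ω m gauss f.1).toReal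
  rw [← ENNReal.toReal_ofReal (Real.exp_pos (R ^ 2 / 2)).le, ← ENNReal.toReal_mul]
  exact ENNReal.toReal_mono (ENNReal.mul_ne_top ENNReal.ofReal_ne_top
    (qSup_lt_top ω m memS_gauss f.2).ne) (pSup_le_qSup_gauss hR m f.1)

theorem denseRange_inclOME : DenseRange (inclOME ω N) := by
  intro f
  rw [mem_closure_iff_nhds_basis ((ESpace.withSeminorms ω N).hasBasis_ball (x := f))]
  rintro ⟨s, r⟩ hr
  have hbd : ∃ R : ℝ, ∀ i ∈ s, ∀ x ∈ i.1.1, ‖x‖ ≤ R := by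
    have hc : IsCompact (⋃ i ∈ s, i.1.1) := s.isCompact_biUnion fun i _ => i.1.2
    obtain ⟨R, hR⟩ := hc.isBounded.exists_norm_le
    exact ⟨R, fun i hi x hx => hR x (mem_biUnion hi hx)⟩
  obtain ⟨R, hR⟩ := hbd
  -- With radius R + 1, χ f - f vanishes near every point of the finitely many compact sets, so
  -- those seminorms of it are exactly 0.
  obtain ⟨χ, hχ, hχ1, hχc⟩ := exists_ultraBounded_cutoff ω N (R + 1)
  refine ⟨_, ⟨⟨_, hχ.mul_mem_OMSubmodule hχc f.2⟩, rfl⟩, ?_⟩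
  rw [Seminorm.mem_ball]
  refine lt_of_le_of_lt (Seminorm.finset_sup_apply_le le_rfl fun i hi => ?_) hr
  change (pSup ω i.1.1 i.2 ((fun x => χ x * f.1 x) - f.1)).toReal ≤ 0
  have h0 : pSup ω i.1.1 i.2 ((fun x => χ x * f.1 x) - f.1) = 0 := by
    refine le_antisymm (iSup₂_le fun x hx => iSup_le fun α => ?_) zero_le
    have hev : ((fun x => χ x * f.1 x) - f.1) =ᶠ[nhds x] fun _ => 0 := by
      have hball : Metric.ball (0 : EuclideanSpace ℝ (Fin N)) (R + 1) ∈ nhds x :=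
        Metric.isOpen_ball.mem_nhds (by
          rw [mem_ball_zero_iff]
          linarith [hR i hi x hx])
      filter_upwards [hball] with y hy
      rw [Pi.sub_apply, hχ1 y (mem_ball_zero_iff.1 hy).le, one_mul, sub_self]
    have h1 : partialDeriv α ((fun x => χ x * f.1 x) - f.1) x = 0 := by
      rw [partialDeriv, (hev.iteratedFDeriv ℝ _).self_of_nhds]
      exact partialDeriv_zero α x
    rw [h1, enorm_zero, zero_mul]
  rw [h0, ENNReal.toReal_zero]

instance : T2Space (OMSpace ω N) := by
  have h := (OMSpace.withSeminorms ω N).T1_of_separating fun f hf => by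
    by_contra hcon
    push Not at hcon
    refine hf (Subtype.ext (funext fun x => ?_))
    obtain ⟨m, C, hC0, hC⟩ := exists_norm_iteratedFDeriv_le ω N 0 ‖x‖
    have h1 := hC f.1 f.2 x le_rfl
    have h2 : (qSup ω m gauss f.1).toReal = 0 := hcon (m, ⟨gauss, memS_gauss⟩)
    rw [h2, mul_zero, norm_iteratedFDeriv_zero] at h1
    exact norm_le_zero_iff.1 h1
  infer_instance

variable {ω N}

theorem Cauchy.eventually_OMSeminorm_sub_lt {F : Filter (OMSpace ω N)} (hF : Cauchy F)
    (i : ℕ+ × {g : EuclideanSpace ℝ (Fin N) → ℂ // MemS ω g}) {ε : ℝ} (hε : 0 < ε) :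
    ∀ᶠ p in F ×ˢ F, OMSeminorm ω N i (p.1 - p.2) < ε := by
  have h1 := hF.2
  rw [uniformity_eq_comap_nhds_zero_swapped] at h1
  have h2 := ((OMSpace.withSeminorms ω N).continuous_seminorm i).tendsto 0
  rw [map_zero] at h2
  exact (h2.comp (Filter.map_le_iff_le_comap.2 h1)).eventually (gt_mem_nhds hε)

theorem Cauchy.uniformCauchySeqOn_iteratedFDeriv {F : Filter (OMSpace ω N)} (hF : Cauchy F)
    (k : ℕ) (R : ℝ) :
    UniformCauchySeqOn (fun (f : OMSpace ω N) x => iteratedFDeriv ℝ k f.1 x) F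
      (Metric.closedBall 0 R) := by
  obtain ⟨m, C, hC0, hC⟩ := exists_norm_iteratedFDeriv_le ω N k R
  intro u hu
  obtain ⟨ε, hε, hu⟩ := Metric.mem_uniformity_dist.1 hu
  filter_upwards [hF.eventually_OMSeminorm_sub_lt (m, ⟨gauss, memS_gauss⟩)
    (ε := ε / (C + 1)) (by positivity)] with p hp x hx
  refine hu ?_
  have h1 := hC (p.1 - p.2).1 (p.1 - p.2).2 x (mem_closedBall_zero_iff.1 hx)
  have h2 : (qSup ω m gauss (p.1 - p.2).1).toReal < ε / (C + 1) := hp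
  have h3 : iteratedFDeriv ℝ k (p.1 - p.2).1 x =
      iteratedFDeriv ℝ k p.1.1 x - iteratedFDeriv ℝ k p.2.1 x :=
    iteratedFDeriv_sub_apply (p.1.2.1.of_le (by exact_mod_cast le_top)).contDiffAt
      (p.2.2.1.of_le (by exact_mod_cast le_top)).contDiffAt
  rw [h3] at h1
  rw [dist_eq_norm]
  refine h1.trans_lt ?_
  rw [lt_div_iff₀ (by positivity)] at h2
  have h4 := ENNReal.toReal_nonneg (a := qSup ω m gauss (p.1 - p.2).1)
  nlinarith

/-- A `τ`-Cauchy filter converges, with all derivatives, to a smooth function. -/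
theorem Cauchy.exists_tendsto_iteratedFDeriv {F : Filter (OMSpace ω N)} (hF : Cauchy F) :
    ∃ h : EuclideanSpace ℝ (Fin N) → ℂ, ContDiff ℝ (⊤ : ℕ∞) h ∧ ∀ k x,
      Filter.Tendsto (fun f : OMSpace ω N => iteratedFDeriv ℝ k f.1 x) F
        (nhds (iteratedFDeriv ℝ k h x)) := by
  have : F.NeBot := hF.1
  have hlim : ∀ k x, ∃ y, Filter.Tendsto (fun f : OMSpace ω N => iteratedFDeriv ℝ k f.1 x) F
      (nhds y) := fun k x => by
    have hc : Cauchy (F.map fun f : OMSpace ω N => iteratedFDeriv ℝ k f.1 x) :=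
      (hF.uniformCauchySeqOn_iteratedFDeriv k ‖x‖).cauchy_map (by simp)
    exact CompleteSpace.complete hc
  choose p hp using hlim
  have hunif : ∀ k R, TendstoUniformlyOn (fun (f : OMSpace ω N) x => iteratedFDeriv ℝ k f.1 x)
      (p k) F (Metric.closedBall 0 R) := fun k R =>
    (hF.uniformCauchySeqOn_iteratedFDeriv k R).tendstoUniformlyOn_of_tendsto fun x _ => hp k x
  -- Locally uniform convergence of derivatives makes the pointwise limits p k a Taylor series of p
  -- 0.
  have hder : ∀ k x, HasFDerivAt (p k) (p (k + 1) x).curryLeft x := fun k x => by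
    have hu := (continuousMultilinearCurryLeftEquiv ℝ
      (fun _ : Fin (k + 1) => EuclideanSpace ℝ (Fin N)) ℂ).isometry.uniformContinuous
        |>.comp_tendstoUniformlyOn (hunif (k + 1) (‖x‖ + 1))
    refine hasFDerivAt_of_tendstoLocallyUniformlyOn (l := F)
      (f := fun (f : OMSpace ω N) x => iteratedFDeriv ℝ k f.1 x)
      (f' := fun (f : OMSpace ω N) x => (iteratedFDeriv ℝ (k + 1) f.1 x).curryLeft)
      (g' := fun x => (p (k + 1) x).curryLeft)
      Metric.isOpen_ball (s := Metric.ball 0 (‖x‖ + 1))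
      (hu.mono Metric.ball_subset_closedBall).tendstoLocallyUniformlyOn
      (fun f y _ => ?_) (fun y _ => hp k y) (by simp)
    have hd : DifferentiableAt ℝ (iteratedFDeriv ℝ k f.1) y :=
      (f.2.1.differentiable_iteratedFDeriv (by exact_mod_cast ENat.natCast_lt_top k)) y
    have := hd.hasFDerivAt
    rw [fderiv_iteratedFDeriv] at this
    exact this
  have hT : HasFTaylorSeriesUpTo ((⊤ : ℕ∞) : WithTop ℕ∞) (fun x => p 0 x 0)
      (fun x k => p k x) :=
    { zero_eq := fun x => rfl
      fderiv := fun k _ x => hder k x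
      cont := fun k _ => continuous_iff_continuousAt.2 fun x => (hder k x).continuousAt }
  refine ⟨fun x => p 0 x 0, hT.contDiff, fun k x => ?_⟩
  rw [← hT.eq_iteratedFDeriv (m := k) (by exact_mod_cast le_top) x]
  exact hp k x

instance : CompleteSpace (OMSpace ω N) := by
  refine ⟨fun {F} hF => ?_⟩
  have : F.NeBot := hF.1
  obtain ⟨h, hs, hlim⟩ := hF.exists_tendsto_iteratedFDeriv
  have hclose : ∀ (m : ℕ+) (g) (_ : MemS ω g) {ε : ℝ}, 0 < ε →
      ∀ᶠ f in F, qSup ω m g (f.1 - h) ≤ ENNReal.ofReal ε := by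
    intro m g hg ε hε
    -- Freeze f and let f' run along the filter: for each α and x the bound on f - f' passes to f -
    -- h, and then to the supremum.
    filter_upwards [(hF.eventually_OMSeminorm_sub_lt (m, ⟨g, hg⟩) hε).curry] with f hf
    refine iSup₂_le fun α x => ?_
    have hpd : ∀ f' : EuclideanSpace ℝ (Fin N) → ℂ, ContDiff ℝ (⊤ : ℕ∞) f' →
        partialDeriv α (f.1 - f') x = partialDeriv α f.1 x - partialDeriv α f' x := fun f' hf' => by
      unfold partialDeriv
      rw [iteratedFDeriv_sub_apply (f.2.1.of_le (by exact_mod_cast le_top)).contDiffAt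
        (hf'.of_le (by exact_mod_cast le_top)).contDiffAt]
      rfl
    have ht : Filter.Tendsto (fun f' : OMSpace ω N => partialDeriv α (f.1 - f'.1) x) F
        (nhds (partialDeriv α (f.1 - h) x)) := by
      rw [hpd h hs]
      have : (fun f' : OMSpace ω N => partialDeriv α (f.1 - f'.1) x) =
          fun f' => partialDeriv α f.1 x - partialDeriv α f'.1 x :=
        funext fun f' => hpd f'.1 f'.2.1
      rw [this]
      exact (((ContinuousMultilinearMap.apply ℝ _ ℂ _).continuous.tendsto _).comp
        (hlim _ x)).const_sub _
    have ht' : Filter.Tendsto (fun f' : OMSpace ω N =>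
        ‖g x‖ₑ * ‖partialDeriv α (f.1 - f'.1) x‖ₑ * ω.factor m (∑ i, α i)) F
        (nhds (‖g x‖ₑ * ‖partialDeriv α (f.1 - h) x‖ₑ * ω.factor m (∑ i, α i))) :=
      ENNReal.Tendsto.mul_const (ENNReal.Tendsto.const_mul ht.enorm (Or.inr enorm_ne_top))
        (Or.inr (ω.factor_ne_top m _))
    refine le_of_tendsto ht' ?_
    filter_upwards [hf] with f' hf'
    have h1 : (qSup ω m g (f.1 - f'.1)).toReal < ε := hf'
    have h2 : qSup ω m g (f.1 - f'.1) ≠ ∞ := (qSup_lt_top ω m hg (f - f').2).ne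
    refine le_trans (le_iSup₂_of_le α x le_rfl) (?_ : qSup ω m g (f.1 - f'.1) ≤ _)
    rw [← ENNReal.ofReal_toReal h2]
    exact ENNReal.ofReal_le_ofReal h1.le
  -- One f at finite q_{m,g}-distance from h gives q_{m,g}(h) < ∞. The choice of f may depend on m
  -- and g, as the criterion needs only finiteness.
  have hmem : h ∈ OMSubmodule ω N := by
    refine mem_OMSubmodule_of_qSup_lt_top hs fun m g hg => ?_
    obtain ⟨f, hf⟩ := (hclose m g hg one_pos).exists
    have hfs : ContDiff ℝ (⊤ : ℕ∞) (f.1 - h) := f.2.1.sub hs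
    have h1 : h = f.1 + (-1 : ℂ) • (f.1 - h) := by
      funext x
      simp
    rw [h1]
    have hfs' : ContDiff ℝ (⊤ : ℕ∞) ((-1 : ℂ) • (f.1 - h)) := contDiff_const.smul hfs
    refine (qSup_add_le ω m g f.2.1 hfs').trans_lt ?_
    rw [qSup_smul ω m g _ hfs]
    exact ENNReal.add_lt_top.2 ⟨qSup_lt_top ω m hg f.2,
      ENNReal.mul_lt_top enorm_lt_top (hf.trans_lt ENNReal.ofReal_lt_top)⟩
  refine ⟨(⟨h, hmem⟩ : OMSubmodule ω N), ?_⟩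
  refine ((OMSpace.withSeminorms ω N).tendsto_nhds id _).2 fun i ε hε => ?_
  filter_upwards [hclose i.1 i.2.1 i.2.2 (half_pos hε)] with f hf
  change (qSup ω i.1 i.2.1 (f.1 - h)).toReal < ε
  exact (ENNReal.toReal_le_of_le_ofReal (half_pos hε).le hf).trans_lt (half_lt_self hε)

end Topology

theorem theorem5p2 (ω : NQWeight) (N : ℕ) :
    (Continuous (inclOME ω N) ∧ DenseRange (inclOME ω N)) ∧
    (IsUniformAddGroup (OMSpace ω N) ∧ ContinuousSMul ℂ (OMSpace ω N) ∧
      LocallyConvexSpace ℝ (OMSpace ω N) ∧ T2Space (OMSpace ω N) ∧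
      CompleteSpace (OMSpace ω N)) :=
  ⟨⟨continuous_inclOME ω N, denseRange_inclOME ω N⟩, inferInstance,
    (OMSpace.withSeminorms ω N).continuousSMul, (OMSpace.withSeminorms ω N).toLocallyConvexSpace,
    inferInstance, inferInstance⟩
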